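/- **Theorem (formula for a region of type D).** Let $q$ be an indeterminate over $\mathbb{Q}$ or, more generally, a non-zero element of a field of characteristic $0$ such that $[k]_{q^2}\neq 0$ for all $k\ge 1$, where $[k]_r:=1+r+\dots+r^{k-1}$ and $[k]_r!:=[1]_r[2]_r\cdots[k]_r$. Let $x,u,n$ be non-negative integers with $n\le u$ and let $1\le h_1<h_2<\dots<h_n\le u$ be integers. *The region.* On the triangular lattice (with horizontal lattice lines) use coordinates $(i,j)$ in which the unit of the horizontal coordinate $i$ is half the length of a unit edge and the unit of the vertical coordinate $j$ is half the height of a vertical lozenge (a vertical lozenge is the union of an up-pointing unit triangle and the down-pointing unit triangle below it that share a horizontal edge). Consider the halved hexagon with upper left vertex $(0,2u+1)$ whose north, northeast, southeast and south sides follow lattice lines and have lengths $x,\ 2u-n+1,\ n,\ x+u-n$, and whose west side, read from the top, consists of $2u$ unit steps going alternately to the lower left and to the lower right, followed by one more unit step to the lower right (so that the bottom-most segment of the zigzag has length $2$); its south side lies on $j=0$. The west side has $u$ bumps, labelled $1,\dots,u$ from bottom to top; each consists of an up-pointing unit triangle and the down-pointing unit triangle below it. For every $k\in\{1,\dots,u\}\setminus\{h_1,\dots,h_n\}$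 remove the up-pointing unit triangle of the $k$-th bump. Let $D_{x,u}(h_1,\dots,h_n)$ be the resulting region with the following weights $\mathrm{wt}_2$ of lozenges: a vertical lozenge with center $(i,j)$ has weight $\frac{q^i+q^{-i}}2$ if $i\ne0$ and weight $\frac12$ if $i=0$ (i.e. if the $j$-axis, which passes through the centers of the vertical lozenges in the bumps of the west side, cuts it); all other lozenges have weight $1$. The weight of a lozenge tiling is the product of the weights of its lozenges, and $\mathrm{M}(D_{x,u}(h_1,\dots,h_n))$ is the sum of the weights of all lozenge tilings of the region (equal to $1$ for the empty region). *The product.* For non-negative integers $x,u,d$ and integers $1\le l_1<\dots<l_m\le d$, $1\le h_1<\dots<h_n\le u$ put $e=\min(u-n,d-m)$, $\overline{x}=x+\max(u-n,d-m)$, $t_1=2(x+u-n-e)+1$, $t_2=2(x+d-m-e)$, $f(t,y,z)=\frac{yz(2t+y-z)}2$, $\left\langle{b\atop a}\right\rangle=a+(a+1)+\dots+b$, $$E=f(t_1+2d-m,n,m+1)+\sum_{i=1}^m\left\langle{t_1+2d-m-(m-i+1)\atop t_1+2(d-l_i)-2(m-i)}\right\rangle+\sum_{i=1}^n\left\langle{t_2+2u-n-(n-i+1)\atop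 t_2+2(u-h_i)-2(n-i)}\right\rangle,$$ $$F=n(m+1)+\sum_{i=1}^m(2l_i-i)+\sum_{i=1}^n(2h_i-i),$$ and $$\begin{aligned}P(x,u,d,(l_i)_{i=1}^m,(h_j)_{j=1}^n)=\;&2^{-F}q^{-E}\frac{\prod_{1\le i<j\le m}[2(l_j-l_i)]_{q^2}\prod_{1\le i<j\le n}[2(h_j-h_i)]_{q^2}}{\prod_{i=1}^m\prod_{j=1}^n[2(l_i+h_j)]_{q^2}\prod_{i=1}^m[2l_i-1]_{q^2}!\prod_{j=1}^n[2h_j]_{q^2}!}\\ &\times\prod_{i=1}^{\lceil m/2\rceil}\prod_{j=1}^{2m-4i+3}[2\overline{x}+2i+j-1]_{q^2}\prod_{i=1}^n[2(\overline{x}+m+i)]_{q^2}\prod_{i=1}^n\prod_{j=1}^{m+i}[2\overline{x}+m+i+j]_{q^2}\\ &\times\prod_{i=1}^m\prod_{j=1}^n\frac{[2(\overline{x}+i+j-1)]_{q^2}}{[2(\overline{x}+i+j-1)+1]_{q^2}}\prod_{i=1}^m\prod_{j=1}^{l_i-i}[2(\overline{x}+i+j+n)]_{q^2}[2(\overline{x}-i-j+m+1)]_{q^2}\\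 &\times\prod_{i=1}^n\prod_{j=1}^{h_i-i}[2(\overline{x}+i+j+m)]_{q^2}[2(\overline{x}-i-j+n+1)]_{q^2}.\end{aligned}$$ *Claim.* $$\mathrm{M}(D_{x,u}(h_1,\dots,h_n))=P(x,u,0,\emptyset,(h_j)_{j=1}^n).$$ -/

import Mathlib

open Finset

/-!
# The triangular lattice

Horizontal coordinates `i` are measured in half-edges and heights `j` in half-heights of a
vertical lozenge, so the horizontal lattice lines are the lines of integer height.  The lattice is
placed so that its vertices are the points `(i, j)` with `i + j` odd.

The unit triangle lying between heights `j` and `j + 1` whose horizontal side has midpoint of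
abscissa `a` is named by the pair `(a, j)`; every pair of integers names exactly one triangle, and
the triangles of one row follow each other from left to right as `a` increases.  If `a + j` is
even, the triangle has vertices `(a - 1, j)`, `(a + 1, j)`, `(a, j + 1)` (up-pointing); if `a + j`
is odd, it has vertices `(a - 1, j + 1)`, `(a + 1, j + 1)`, `(a, j)` (down-pointing).
-/

/-- Unit triangles of the triangular lattice. -/
abbrev UnitTriangle : Type := ℤ × ℤ

/-- The up-pointing unit triangles. -/
def UnitTriangle.IsUp (t : UnitTriangle) : Prop := Even (t.1 + t.2)

instance : DecidablePred UnitTriangle.IsUp :=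
  fun t => inferInstanceAs (Decidable (Even (t.1 + t.2)))

/-- Which edge the two unit triangles of a lozenge share: the horizontal side of the up-pointing
triangle (a vertical lozenge), its left side, or its right side. -/
inductive LozengeKind where
  | vertical
  | left
  | right
deriving DecidableEq

instance : Fintype LozengeKind :=
  ⟨{.vertical, .left, .right}, fun x => by cases x <;> simp⟩

/-- A lozenge is given by its up-pointing triangle and by its kind. -/
abbrev Lozenge : Type := UnitTriangle × LozengeKind

/-- The down-pointing triangle of a lozenge. -/
def Lozenge.downTriangle : Lozenge → UnitTriangle
  | ((a, j), .vertical) => (a, j - 1)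
  | ((a, j), .left) => (a - 1, j)
  | ((a, j), .right) => (a + 1, j)

/-- The two unit triangles that make up a lozenge. -/
def Lozenge.cells (L : Lozenge) : Finset UnitTriangle := {L.1, L.downTriangle}

/-- The lozenges contained in a region, i.e. in a finite set of unit triangles. -/
def lozengesIn (R : Finset UnitTriangle) : Finset Lozenge :=
  ((R.filter UnitTriangle.IsUp) ×ˢ (univ : Finset LozengeKind)).filter fun L => L.cells ⊆ R

/-- The lozenge tilings of a region: the sets of lozenges contained in the region such that every
unit triangle of the region belongs to exactly one lozenge of the set. -/
def lozengeTilings (R : Finset UnitTriangle) : Finset (Finset Lozenge) :=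
  (lozengesIn R).powerset.filter fun T => ∀ t ∈ R, #{L ∈ T | t ∈ L.cells} = 1

/-- The tiling generating function `M(R)` of a region with a weight assignment for lozenges. -/
def tilingGF {K : Type*} [Field K] (R : Finset UnitTriangle) (wt : Lozenge → K) : K :=
  ∑ T ∈ lozengeTilings R, ∏ L ∈ T, wt L

/-- The weight assignment `wt₂`.  The vertical lozenge with up-pointing triangle `(a, j)` has
center `(a, j)`, and it is cut by the `j`-axis exactly when `a = 0`. -/
def wt₂ {K : Type*} [Field K] (q : K) : Lozenge → K
  | ((a, _), .vertical) => if a = 0 then 1 / 2 else (q ^ a + q ^ (-a)) / 2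
  | (_, .left) => 1
  | (_, .right) => 1

/-- The halved hexagon with north, northeast, southeast and south sides of lengths
`x`, `2u - n + 1`, `n`, `x + u - n`, with upper left vertex `(0, 2u + 1)`.  Its rows are
`0, …, 2u` from bottom to top.

West side, from top to bottom: `2u` unit steps alternately to the lower left and to the lower
right, between the abscissas `0` and `-1`, followed by one more unit step to the lower right in
row `0` (so the last segment of the zigzag has length `2`).  Hence row `0` starts with the triangle
of abscissa `1`, all others with that of abscissa `0`.

East side, from top to bottom: `2u - n + 1` unit steps to the lower right, from `(2x, 2u + 1)` to
`(2x + 2u - n + 1, n)`, then `n` unit steps to the lower left, to `(2x + 2u - 2n + 1, 0)`.  Hence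
row `j` ends with the triangle of abscissa `2x + 2u - j` if `n ≤ j`, and
`2x + 2u - 2n + 1 + j` if `j < n`; this is the smaller of these two numbers. -/
noncomputable def halvedHexagonB (x u n : ℕ) : Finset UnitTriangle :=
  ((Icc (0 : ℤ) (2 * x + 2 * u)) ×ˢ (Icc (0 : ℤ) (2 * u))).filter fun t =>
    (t.2 = 0 → 1 ≤ t.1) ∧
      t.1 ≤ min (2 * x + 2 * u - t.2 : ℤ) (2 * x + 2 * u - 2 * n + 1 + t.2)

/-- The `k`-th bump on the west side, counted from the bottom (`1 ≤ k ≤ u`), consists of the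
up-pointing triangle `(0, 2k)` and of the down-pointing triangle `(0, 2k - 1)` below it.  The dents
are the up-pointing triangles of the bumps at the positions different from `h₁, …, hₙ`. -/
noncomputable def dents (u : ℕ) {n : ℕ} (h : Fin n → ℕ) : Finset UnitTriangle :=
  ((Icc 1 u).filter fun k => ∀ i, h i ≠ k).image fun k : ℕ => ((0 : ℤ), 2 * (k : ℤ))

/-- The shape of the region `D_{x,u}(h₁, …, hₙ)` (the shape of the regions of type `B`). -/
noncomputable def regionD (x u : ℕ) {n : ℕ} (h : Fin n → ℕ) : Finset UnitTriangle :=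
  halvedHexagonB x u n \ dents u h

/-- The `q`-integer `[n]_r = 1 + r + ⋯ + r ^ (n - 1)`. -/
def qInt {K : Type*} [Field K] (r : K) (n : ℕ) : K := ∑ k ∈ range n, r ^ k

/-- The `q`-factorial `[n]_r! = [1]_r [2]_r ⋯ [n]_r`. -/
def qFact {K : Type*} [Field K] (r : K) (n : ℕ) : K := ∏ k ∈ Icc 1 n, qInt r k

/-- The sum `a + (a + 1) + ⋯ + b`. -/
noncomputable def bracketSum (b a : ℤ) : ℤ := ∑ k ∈ Icc a b, k

/-- `f(t, x, y) = x y (2 t + x - y) / 2`; the division is exact. -/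
def fExp (t x y : ℤ) : ℤ := x * y * (2 * t + x - y) / 2

theorem two_mul_fExp (t x y : ℤ) : 2 * fExp t x y = x * y * (2 * t + x - y) := by
  unfold fExp
  refine Int.mul_ediv_cancel' ?_
  rw [← even_iff_two_dvd]
  simp only [Int.even_mul, Int.even_sub, Int.even_add]
  have h2 : Even (2 : ℤ) := even_two
  tauto

/-- The exponent `E`.  Sequences are indexed from `0` in the code, so `l i` is `l_{i+1}`. -/
noncomputable def expE (x u d : ℕ) {m n : ℕ} (l : Fin m → ℕ) (h : Fin n → ℕ) : ℤ :=
  let e : ℤ := min ((u : ℤ) - n) ((d : ℤ) - m)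
  let t₁ : ℤ := 2 * (x + u - n - e) + 1
  let t₂ : ℤ := 2 * (x + d - m - e)
  fExp (t₁ + 2 * d - m) n (m + 1)
    + ∑ i : Fin m, bracketSum (t₁ + 2 * d - m - (m - ((i : ℤ) + 1) + 1))
        (t₁ + 2 * ((d : ℤ) - l i) - 2 * (m - ((i : ℤ) + 1)))
    + ∑ i : Fin n, bracketSum (t₂ + 2 * u - n - (n - ((i : ℤ) + 1) + 1))
        (t₂ + 2 * ((u : ℤ) - h i) - 2 * (n - ((i : ℤ) + 1)))

/-- The exponent `F = n (m + 1) + ∑ (2 l_i - i) + ∑ (2 h_i - i)`. -/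
def expF {m n : ℕ} (l : Fin m → ℕ) (h : Fin n → ℕ) : ℤ :=
  n * (m + 1) + ∑ i : Fin m, (2 * (l i : ℤ) - ((i : ℤ) + 1))
    + ∑ i : Fin n, (2 * (h i : ℤ) - ((i : ℤ) + 1))

/-- The product `P(x, u, d, (l_i), (h_j))` for strictly increasing sequences of positive integers
`l₁, …, l_m ≤ d` and `h₁, …, h_n ≤ u`.  For such sequences none of the subtractions of natural
numbers below is truncated. -/
noncomputable def prodP {K : Type*} [Field K] (q : K) (x u d : ℕ) {m n : ℕ} (l : Fin m → ℕ) (h : Fin n → ℕ) : K :=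
  let X : ℕ := x + max (u - n) (d - m)
  let I : ℕ → K := qInt (q ^ 2)
  2 ^ (-expF l h) * q ^ (-expE x u d l h)
    * ((∏ i : Fin m, ∏ j ∈ Ioi i, I (2 * (l j - l i)))
        * (∏ i : Fin n, ∏ j ∈ Ioi i, I (2 * (h j - h i)))
      / ((∏ i : Fin m, ∏ j : Fin n, I (2 * (l i + h j)))
        * (∏ i : Fin m, qFact (q ^ 2) (2 * l i - 1))
        * (∏ j : Fin n, qFact (q ^ 2) (2 * h j))))
    * (∏ i ∈ Icc 1 ((m + 1) / 2), ∏ j ∈ Icc 1 (2 * m + 3 - 4 * i), I (2 * X + 2 * i + j - 1))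
    * (∏ i ∈ Icc 1 n, I (2 * (X + m + i)))
    * (∏ i ∈ Icc 1 n, ∏ j ∈ Icc 1 (m + i), I (2 * X + m + i + j))
    * (∏ i ∈ Icc 1 m, ∏ j ∈ Icc 1 n, I (2 * (X + i + j - 1)) / I (2 * (X + i + j - 1) + 1))
    * (∏ i : Fin m, ∏ j ∈ Icc 1 (l i - ((i : ℕ) + 1)),
        I (2 * (X + (i + 1) + j + n)) * I (2 * (X + m + 1 - (i + 1) - j)))
    * (∏ i : Fin n, ∏ j ∈ Icc 1 (h i - ((i : ℕ) + 1)),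
        I (2 * (X + (i + 1) + j + m)) * I (2 * (X + n + 1 - (i + 1) - j)))

/-!
# The tiling generating function of a region of type `D`

The tilings are encoded by families of non-intersecting lattice paths, which gives a determinant of
path generating functions; these have a closed form, and the determinant is evaluated in terms of
symmetric `q`-integers.
-/

/-! In a tiling, the `vertical` and `right` lozenges form $n$ non-intersecting lattice paths from
the southeast side to the undented bumps; the `left` lozenges are then forced. The weighted count is
therefore a determinant of one-path generating functions (`tilingGF_regionD_eq_det`). No involution
is needed: the region is swept row by row from the bottom, each row from right to left. At the head
of a path, the down-pointing triangle on its left can be covered in two ways, which matches the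
two-term recursion for one row of the matrix, and the determinant is linear in that row. Two paths
that meet give equal rows, a step out of the region gives a zero row, and at the top the matrix is
the identity.

The one-path generating functions are products (`axisPathGF_step`). With $N=x+u-n+1$ the paths begin
at $(2N+k,k)$, and the recursion, read as row operations, moves these points to $(2N+2k,0)$ at the
cost of explicit factors (`det_eq_prod_mul_det_of_pascal_step`). At height $0$ both the abscissa and
the number of down steps are even. Each entry then becomes, after row and column factors are
extracted, a product of $n-1$ terms $[2(N+l\pm h)]$ (`axisPathGF_mul_eq_crossEntry`), and the
resulting determinant is a constant times a homogeneous Vandermonde determinant (`det_crossEntry`).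

Symmetric $q$-integers keep stray powers of $q$ out of these identities, and their Laurent
polynomial form covers $q^2=1$. What remains is to match factors and powers of $2$ and $q$ with $P$.
-/

/-! ### Lozenge tilings and their expansion at one triangle -/

theorem mem_lozengesIn {R : Finset UnitTriangle} {L : Lozenge} :
    L ∈ lozengesIn R ↔ L.1.IsUp ∧ L.cells ⊆ R := by
  simp only [lozengesIn, mem_filter, mem_product, mem_univ, and_true]
  constructor
  · rintro ⟨⟨_, h⟩, h'⟩
    exact ⟨h, h'⟩
  · rintro ⟨h, h'⟩
    exact ⟨⟨h' (by simp [Lozenge.cells]), h⟩, h'⟩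

theorem mem_lozengeTilings {R : Finset UnitTriangle} {T : Finset Lozenge} :
    T ∈ lozengeTilings R ↔
      (∀ L ∈ T, L.1.IsUp ∧ L.cells ⊆ R) ∧ ∀ t ∈ R, #{L ∈ T | t ∈ L.cells} = 1 := by
  simp only [lozengeTilings, mem_filter, mem_powerset, subset_iff (s₁ := T), mem_lozengesIn]

theorem disjoint_cells_of_mem_lozengeTilings {R : Finset UnitTriangle} {T : Finset Lozenge}
    (hT : T ∈ lozengeTilings R) {L L' : Lozenge} (hL : L ∈ T) (hL' : L' ∈ T) (hne : L ≠ L') :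
    Disjoint L.cells L'.cells := by
  rw [mem_lozengeTilings] at hT
  rw [Finset.disjoint_left]
  intro t ht ht'
  obtain ⟨a, ha⟩ := card_eq_one.1 (hT.2 t ((hT.1 L hL).2 ht))
  have h1 : L ∈ ({L ∈ T | t ∈ L.cells} : Finset _) := by simp [hL, ht]
  have h2 : L' ∈ ({L ∈ T | t ∈ L.cells} : Finset _) := by simp [hL', ht']
  rw [ha, mem_singleton] at h1 h2
  exact hne (h1.trans h2.symm)

theorem fst_mem_cells (L : Lozenge) : L.1 ∈ L.cells := by simp [Lozenge.cells]

theorem erase_mem_lozengeTilings {R : Finset UnitTriangle} {T : Finset Lozenge}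
    (hT : T ∈ lozengeTilings R) {L : Lozenge} (hL : L ∈ T) :
    T.erase L ∈ lozengeTilings (R \ L.cells) := by
  have hT' := mem_lozengeTilings.1 hT
  rw [mem_lozengeTilings]
  refine ⟨fun L' h' => ?_, fun t ht => ?_⟩
  · rw [mem_erase] at h'
    refine ⟨(hT'.1 L' h'.2).1, fun t ht => mem_sdiff.2 ⟨(hT'.1 L' h'.2).2 ht, ?_⟩⟩
    exact Finset.disjoint_left.1 (disjoint_cells_of_mem_lozengeTilings hT h'.2 hL h'.1) ht
  · rw [mem_sdiff] at ht
    rw [← hT'.2 t ht.1]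
    congr 1
    ext L'
    simp only [mem_filter, mem_erase]
    constructor
    · rintro ⟨⟨_, h1⟩, h2⟩
      exact ⟨h1, h2⟩
    · rintro ⟨h1, h2⟩
      exact ⟨⟨fun h => ht.2 (h ▸ h2), h1⟩, h2⟩

theorem insert_mem_lozengeTilings {R : Finset UnitTriangle} {T : Finset Lozenge} {L : Lozenge}
    (hL : L ∈ lozengesIn R) (hT : T ∈ lozengeTilings (R \ L.cells)) :
    L ∉ T ∧ insert L T ∈ lozengeTilings R := by
  have hT' := mem_lozengeTilings.1 hT
  rw [mem_lozengesIn] at hL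
  have hLT : L ∉ T := fun h =>
    (mem_sdiff.1 ((hT'.1 L h).2 (fst_mem_cells L))).2 (fst_mem_cells L)
  refine ⟨hLT, mem_lozengeTilings.2 ⟨fun L' h' => ?_, fun t ht => ?_⟩⟩
  · rcases mem_insert.1 h' with rfl | h'
    · exact hL
    · exact ⟨(hT'.1 L' h').1, (hT'.1 L' h').2.trans sdiff_subset⟩
  · by_cases htL : t ∈ L.cells
    · rw [card_eq_one]
      refine ⟨L, ?_⟩
      ext L'
      simp only [mem_filter, mem_insert, mem_singleton]
      constructor
      · rintro ⟨h1 | h1, h2⟩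
        · exact h1
        · exact absurd htL (mem_sdiff.1 ((hT'.1 L' h1).2 h2)).2
      · rintro rfl
        exact ⟨Or.inl rfl, htL⟩
    · rw [filter_insert, if_neg htL]
      exact hT'.2 t (mem_sdiff.2 ⟨ht, htL⟩)

section
variable {K : Type*} [Field K]

/-- Expansion of the tiling generating function along the lozenge that covers a given triangle. -/
theorem tilingGF_eq_sum {R : Finset UnitTriangle} (wt : Lozenge → K) {t : UnitTriangle}
    (ht : t ∈ R) :
    tilingGF R wt = ∑ L ∈ lozengesIn R with t ∈ L.cells, wt L * tilingGF (R \ L.cells) wt := by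
  have h1 : tilingGF R wt = ∑ T ∈ lozengeTilings R, ∑ L ∈ lozengesIn R with t ∈ L.cells,
      if L ∈ T then ∏ L' ∈ T, wt L' else 0 := by
    refine sum_congr rfl fun T hT => ?_
    obtain ⟨L₀, hL₀⟩ := card_eq_one.1 ((mem_lozengeTilings.1 hT).2 t ht)
    rw [← sum_filter, filter_filter]
    have : ({L ∈ lozengesIn R | t ∈ L.cells ∧ L ∈ T} : Finset _) = {L₀} := by
      rw [← hL₀]
      ext L
      simp only [mem_filter, mem_lozengesIn]
      constructor
      · rintro ⟨_, h1, h2⟩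
        exact ⟨h2, h1⟩
      · rintro ⟨h1, h2⟩
        exact ⟨(mem_lozengeTilings.1 hT).1 L h1, h2, h1⟩
    rw [this, sum_singleton]
  rw [h1, sum_comm]
  refine sum_congr rfl fun L hL => ?_
  rw [mem_filter] at hL
  rw [← sum_filter, tilingGF, mul_sum]
  refine sum_bij' (fun T _ => T.erase L) (fun T _ => insert L T) ?_ ?_ ?_ ?_ ?_
  · intro T hT
    rw [mem_filter] at hT
    exact erase_mem_lozengeTilings hT.1 hT.2
  · intro T hT
    exact mem_filter.2 ⟨(insert_mem_lozengeTilings hL.1 hT).2, mem_insert_self _ _⟩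
  · intro T hT
    exact insert_erase (mem_filter.1 hT).2
  · intro T hT
    exact erase_insert (insert_mem_lozengeTilings hL.1 hT).1
  · intro T hT
    exact (mul_prod_erase T wt (mem_filter.1 hT).2).symm

theorem tilingGF_empty (wt : Lozenge → K) : tilingGF ∅ wt = 1 := by
  have : lozengeTilings ∅ = {∅} := by
    ext T
    rw [mem_lozengeTilings, mem_singleton]
    constructor
    · rintro ⟨h, _⟩
      refine eq_empty_of_forall_notMem fun L hL => ?_
      exact notMem_empty _ ((h L hL).2 (fst_mem_cells L))
    · rintro rfl
      simp
  simp [tilingGF, this]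

theorem mem_cells_of_not_isUp {t : UnitTriangle} (ht : ¬ t.IsUp) {L : Lozenge} (hL : L.1.IsUp) :
    t ∈ L.cells ↔ L = ((t.1, t.2 + 1), .vertical) ∨ L = ((t.1 + 1, t.2), .left) ∨
      L = ((t.1 - 1, t.2), .right) := by
  obtain ⟨a, j⟩ := t
  obtain ⟨⟨b, k⟩, c⟩ := L
  have hne : ((a, j) : ℤ × ℤ) ≠ (b, k) := fun h => ht (h ▸ hL)
  cases c <;> simp only [Lozenge.cells, Lozenge.downTriangle, mem_insert, mem_singleton, hne,
    false_or, Prod.mk.injEq, reduceCtorEq, and_true, and_false, or_false] <;> omega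

theorem mem_cells_of_isUp {t : UnitTriangle} (ht : t.IsUp) {L : Lozenge} (hL : L.1.IsUp) :
    t ∈ L.cells ↔ L.1 = t := by
  obtain ⟨a, j⟩ := t
  obtain ⟨⟨b, k⟩, c⟩ := L
  simp only [UnitTriangle.IsUp] at ht hL
  rw [Int.even_iff] at ht hL
  cases c <;> simp only [Lozenge.cells, Lozenge.downTriangle, mem_insert, mem_singleton,
    Prod.mk.injEq] at * <;> omega

/-- Once the right neighbour is gone, only the up-pointing triangles above and on the left are
available: these are the two ways to continue a path. -/
theorem tilingGF_of_down {R : Finset UnitTriangle} (q : K) {a j : ℤ} (hd : ¬ Even (a + j))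
    (hR : (a, j) ∈ R) (hright : (a + 1, j) ∉ R) :
    tilingGF R (wt₂ q) =
      (if (a, j + 1) ∈ R then
        wt₂ q ((a, j + 1), .vertical) * tilingGF (R \ {(a, j), (a, j + 1)}) (wt₂ q) else 0) +
      (if (a - 1, j) ∈ R then tilingGF (R \ {(a, j), (a - 1, j)}) (wt₂ q) else 0) := by
  have hup1 : Even (a + (j + 1)) := by
    rw [Int.even_iff] at *; omega
  have hup2 : Even (a - 1 + j) := by
    rw [Int.even_iff] at *; omega
  rw [tilingGF_eq_sum _ hR]
  have : ({L ∈ lozengesIn R | (a, j) ∈ L.cells} : Finset _) =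
      (if (a, j + 1) ∈ R then {((a, j + 1), LozengeKind.vertical)} else ∅) ∪
      (if (a - 1, j) ∈ R then {((a - 1, j), LozengeKind.right)} else ∅) := by
    ext L
    rw [mem_filter, mem_lozengesIn]
    constructor
    · rintro ⟨⟨h1, h2⟩, h3⟩
      rw [mem_cells_of_not_isUp (t := (a, j)) hd h1] at h3
      have h4 := h2 (fst_mem_cells L)
      rcases h3 with rfl | rfl | rfl
      · simp_all
      · exact absurd h4 hright
      · simp_all
    · intro h
      rw [mem_union] at h
      rcases h with h | h
      · split_ifs at h with h'
        · rw [mem_singleton] at h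
          subst h
          refine ⟨⟨hup1, ?_⟩, ?_⟩ <;>
            simp [Lozenge.cells, Lozenge.downTriangle, insert_subset_iff, h', hR]
        · simp at h
      · split_ifs at h with h'
        · rw [mem_singleton] at h
          subst h
          refine ⟨⟨hup2, ?_⟩, ?_⟩ <;>
            simp [Lozenge.cells, Lozenge.downTriangle, insert_subset_iff, h', hR]
        · simp at h
  rw [this, sum_union]
  · have e1 : Lozenge.cells ((a, j + 1), .vertical) = {(a, j), (a, j + 1)} := by
      simp [Lozenge.cells, Lozenge.downTriangle, pair_comm]
    have e2 : Lozenge.cells ((a - 1, j), .right) = {(a, j), (a - 1, j)} := by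
      simp [Lozenge.cells, Lozenge.downTriangle, pair_comm]
    congr 1
    · split_ifs <;> simp [e1]
    · split_ifs <;> simp [e2, wt₂]
  · split_ifs <;> simp

theorem filter_cells_of_isUp (R : Finset UnitTriangle) {t : UnitTriangle} (ht : t.IsUp)
    {k : LozengeKind} (hk : ∀ k' ≠ k, Lozenge.downTriangle (t, k') ∉ R) :
    ({L ∈ lozengesIn R | t ∈ L.cells} : Finset _) ⊆ {(t, k)} := by
  intro L hL
  rw [mem_filter, mem_lozengesIn] at hL
  obtain ⟨⟨h1, h2⟩, h3⟩ := hL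
  rw [mem_cells_of_isUp ht h1] at h3
  obtain ⟨t', k'⟩ := L
  simp only at h3
  subst h3
  rw [mem_singleton]
  by_contra hne
  refine hk k' (fun h => hne (h ▸ rfl)) (h2 ?_)
  simp [Lozenge.cells]

/-- Away from the paths the `left` lozenge is forced, and it has weight 1. -/
theorem tilingGF_of_up_forced {R : Finset UnitTriangle} (q : K) {a j : ℤ} (hu : Even (a + j))
    (hR : (a, j) ∈ R) (hright : (a + 1, j) ∉ R) (hbelow : (a, j - 1) ∉ R)
    (hleft : (a - 1, j) ∈ R) :
    tilingGF R (wt₂ q) = tilingGF (R \ {(a, j), (a - 1, j)}) (wt₂ q) := by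
  rw [tilingGF_eq_sum _ hR]
  have : ({L ∈ lozengesIn R | (a, j) ∈ L.cells} : Finset _) = {((a, j), .left)} := by
    refine Subset.antisymm (filter_cells_of_isUp R (t := (a, j)) hu ?_) ?_
    · rintro (_ | _ | _) h <;> simp_all [Lozenge.downTriangle]
    · rw [singleton_subset_iff, mem_filter, mem_lozengesIn]
      refine ⟨⟨hu, ?_⟩, ?_⟩ <;>
        simp [Lozenge.cells, Lozenge.downTriangle, insert_subset_iff, hR, hleft]
  rw [this, sum_singleton]
  simp [wt₂, Lozenge.cells, Lozenge.downTriangle]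

theorem tilingGF_of_up_isolated {R : Finset UnitTriangle} (wt : Lozenge → K) {a j : ℤ}
    (hu : Even (a + j)) (hR : (a, j) ∈ R) (hright : (a + 1, j) ∉ R) (hbelow : (a, j - 1) ∉ R)
    (hleft : (a - 1, j) ∉ R) :
    tilingGF R wt = 0 := by
  rw [tilingGF_eq_sum _ hR]
  refine sum_eq_zero fun L hL => ?_
  exfalso
  have h1 := filter_cells_of_isUp R (t := (a, j)) (k := .left) hu
    (by rintro (_ | _ | _) h <;> simp_all [Lozenge.downTriangle]) hL
  rw [mem_singleton] at h1
  subst h1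
  rw [mem_filter, mem_lozengesIn] at hL
  exact hleft (hL.1.2 (by simp [Lozenge.cells, Lozenge.downTriangle]))

end

/-! ### Positions of the paths during the sweep -/

/-- The abscissa from which row `j` of the halved hexagon is traversed leftwards: its last
up-pointing triangle, or the up-pointing triangle just beyond its last triangle. -/
def rowEnd (x u n : ℕ) (j : ℤ) : ℤ := min (2 * x + 2 * u - j) (2 * x + 2 * u - 2 * n + 2 + j)

theorem mem_regionD {x u n : ℕ} {h : Fin n → ℕ} {a j : ℤ} :
    (a, j) ∈ regionD x u h ↔ 0 ≤ a ∧ 0 ≤ j ∧ j ≤ 2 * u ∧ (j = 0 → 1 ≤ a) ∧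
      a ≤ 2 * x + 2 * u - j ∧ a ≤ 2 * x + 2 * u - 2 * n + 1 + j ∧
      (a = 0 → Even j → ∃ i, j = 2 * h i) := by
  simp only [regionD, halvedHexagonB, dents, mem_sdiff, mem_filter, mem_product, mem_Icc,
    le_min_iff, mem_image, Prod.mk.injEq, not_exists, not_and]
  constructor
  · rintro ⟨⟨⟨⟨h1, h2⟩, h3, h4⟩, h5, h6, h7⟩, h8⟩
    refine ⟨h1, h3, h4, h5, h6, h7, fun ha hj => ?_⟩
    obtain ⟨k, rfl⟩ := hj
    by_contra hne
    push Not at hne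
    refine h8 k.toNat ⟨⟨?_, ?_⟩, fun i hi => hne i ?_⟩ ha.symm ?_ <;> omega
  · rintro ⟨h1, h2, h3, h4, h5, h6, h7⟩
    refine ⟨⟨⟨⟨h1, by omega⟩, h2, h3⟩, h4, h5, h6⟩, ?_⟩
    rintro k ⟨⟨hk1, hk2⟩, hk3⟩ rfl rfl
    obtain ⟨i, hi⟩ := h7 rfl ⟨k, by ring⟩
    exact hk3 i (by omega)

/-- What is left of a region when the rows below `j`, the part of row `j` to the right of the
abscissa `b`, and the current positions of the paths have been removed. -/
noncomputable def remainingRegion (R : Finset UnitTriangle) {n : ℕ} (p : Fin n → ℤ × ℤ)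
    (j b : ℤ) : Finset UnitTriangle :=
  {t ∈ R | (j < t.2 ∨ t.2 = j ∧ t.1 ≤ b) ∧ ∀ k, p k ≠ t}

/-- The possible positions of the `n` paths of lozenges when the rows below `j` and the part of
row `j` to the right of `b` have been tiled. -/
structure IsPathState (x u : ℕ) {n : ℕ} (h : Fin n → ℕ) (p : Fin n → ℤ × ℤ) (j b : ℤ) :
    Prop where
  lex : ∀ k k', k < k' → (p k).2 < (p k').2 ∨ (p k).2 = (p k').2 ∧ (p k).1 < (p k').1
  even : ∀ k, Even ((p k).1 + (p k).2)
  nonneg : ∀ k, 0 ≤ (p k).1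
  le_top : ∀ k, (p k).2 ≤ 2 * u
  start : ∀ k, (p k).1 = 0 → ∃ i, (p k).2 = 2 * h i
  -- The four cases: finished at the axis in a lower row; still to be treated in row `j`; already
  -- moved up to row `j + 1`; not yet started.
  location : ∀ k, ((p k).2 < j ∧ (p k).1 = 0) ∨ ((p k).2 = j ∧ (p k).1 ≤ b) ∨
    ((p k).2 = j + 1 ∧ b + 1 ≤ (p k).1 ∧ (p k).1 ≤ rowEnd x u n (j + 1)) ∨
    (j + 1 ≤ (k : ℕ) ∧ (p k).1 = 2 * (x : ℤ) + 2 * u - 2 * n + 2 + (k : ℕ) ∧ (p k).2 = (k : ℕ))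
  initial : ∀ k : Fin n, j < (k : ℕ) ∨ j = (k : ℕ) ∧ 2 * (x : ℤ) + 2 * u - 2 * n + 2 + (k : ℕ) ≤ b →
    (p k).1 = 2 * (x : ℤ) + 2 * u - 2 * n + 2 + (k : ℕ) ∧ (p k).2 = (k : ℕ)

theorem IsPathState.injective {x u n : ℕ} {h : Fin n → ℕ} {p : Fin n → ℤ × ℤ} {j b : ℤ}
    (hp : IsPathState x u h p j b) : Function.Injective p := by
  intro k k' hkk
  rcases lt_trichotomy k k' with hlt | heq | hlt
  · rcases hp.lex _ _ hlt with h1 | h1 <;> rw [hkk] at h1 <;> omega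
  · exact heq
  · rcases hp.lex _ _ hlt with h1 | h1 <;> rw [hkk] at h1 <;> omega

/-- Heads already in row `j + 1` lie to the right of `b`, so an upward step never runs into another
path; only leftward steps can. -/
theorem IsPathState.not_mem_shift {x u n : ℕ} {h : Fin n → ℕ} {p : Fin n → ℤ × ℤ} {j b : ℤ}
    (hp : IsPathState x u h p j b) (hb : b ≤ rowEnd x u n j)
    (k : Fin n) : p k ≠ (b - 1, j + 1) := by
  intro hk
  have := hp.location k
  simp only [rowEnd] at *
  rw [hk] at this
  simp only at this
  omega

theorem IsPathState.shift_up {x u n : ℕ} {h : Fin n → ℕ} {p : Fin n → ℤ × ℤ} {j b : ℤ}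
    (hp : IsPathState x u h p j b) (hb : b ≤ rowEnd x u n j) (hb1 : 1 ≤ b) {i : Fin n}
    (hi : p i = (b, j)) (htop : j + 1 ≤ 2 * u)
    (hstart : b = 1 → ∃ i, j + 1 = 2 * h i) :
    IsPathState x u h (Function.update p i (b - 1, j + 1)) j (b - 2) := by
  have hi1 : (p i).1 = b := by rw [hi]
  have hi2 : (p i).2 = j := by rw [hi]
  have hev := hp.even i
  rw [hi] at hev
  have hbe : b - 1 ≤ rowEnd x u n (j + 1) := by
    clear hstart
    simp only [rowEnd] at *
    omega
  constructor
  · intro k k' hkk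
    have h1 := hp.lex k k' hkk
    by_cases hk : k = i
    · subst hk
      rw [Function.update_self, Function.update_of_ne hkk.ne']
      have h2 := hp.location k'
      clear hstart
      simp only [rowEnd] at *
      omega
    · rw [Function.update_of_ne hk]
      by_cases hk' : k' = i
      · subst hk'
        rw [Function.update_self]
        simp only
        omega
      · rw [Function.update_of_ne hk']
        exact h1
  · intro k
    by_cases hk : k = i
    · subst hk
      simp only [Function.update_self]
      convert hev using 1
      ring
    · rw [Function.update_of_ne hk]; exact hp.even k
  · intro k
    by_cases hk : k = i
    · subst hk; simp only [Function.update_self]; omega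
    · rw [Function.update_of_ne hk]; exact hp.nonneg k
  · intro k
    by_cases hk : k = i
    · subst hk; simp only [Function.update_self]; omega
    · rw [Function.update_of_ne hk]; exact hp.le_top k
  · intro k
    by_cases hk : k = i
    · subst hk; simp only [Function.update_self]
      intro hb0
      exact hstart (by omega)
    · rw [Function.update_of_ne hk]; exact hp.start k
  · intro k
    by_cases hk : k = i
    · subst hk; simp only [Function.update_self]
      right; right; left
      exact ⟨trivial, by omega, hbe⟩
    · rw [Function.update_of_ne hk]
      have h1 := hp.location k
      have h2 : (p k).1 ≠ b ∨ (p k).2 ≠ j := by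
        by_contra hcon
        push Not at hcon
        exact hk (hp.injective (Prod.ext (hcon.1.trans hi1.symm) (hcon.2.trans hi2.symm)))
      have h3 := hp.even k
      rw [Int.even_iff] at h3 hev
      omega
  · intro k hk
    have hki : k ≠ i := by
      rintro rfl
      have := hp.initial k (by omega)
      clear hstart
      simp only [rowEnd] at *
      omega
    rw [Function.update_of_ne hki]
    exact hp.initial k (by omega)

theorem IsPathState.shift_left {x u n : ℕ} {h : Fin n → ℕ} {p : Fin n → ℤ × ℤ} {j b : ℤ}
    (hp : IsPathState x u h p j b) (hb : b ≤ rowEnd x u n j) (hb1 : 2 ≤ b)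
    {i : Fin n} (hi : p i = (b, j)) (hfree : ∀ k, p k ≠ (b - 2, j))
    (hstart : b = 2 → ∃ i, j = 2 * h i) :
    IsPathState x u h (Function.update p i (b - 2, j)) j (b - 2) := by
  have hi1 : (p i).1 = b := by rw [hi]
  have hi2 : (p i).2 = j := by rw [hi]
  have hev := hp.even i
  rw [hi] at hev
  have hloc : ∀ k ≠ i, (p k).2 = j → (p k).1 ≤ b → (p k).1 < b - 2 := by
    intro k hk h1 h2
    have h2' : (p k).1 ≠ b := fun hcon =>
      hk (hp.injective (Prod.ext (hcon.trans hi1.symm) (h1.trans hi2.symm)))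
    have h2'' : (p k).1 ≠ b - 2 := fun hcon => hfree k (Prod.ext hcon h1)
    have h3 := hp.even k
    rw [Int.even_iff] at h3 hev
    omega
  constructor
  · intro k k' hkk
    have h1 := hp.lex k k' hkk
    by_cases hk : k = i
    · subst hk
      rw [Function.update_self, Function.update_of_ne hkk.ne']
      simp only
      omega
    · rw [Function.update_of_ne hk]
      by_cases hk' : k' = i
      · subst hk'
        rw [Function.update_self]
        have := hloc k hk
        simp only
        omega
      · rw [Function.update_of_ne hk']
        exact h1
  · intro k
    by_cases hk : k = i
    · subst hk
      simp only [Function.update_self]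
      rw [Int.even_iff] at hev ⊢
      omega
    · rw [Function.update_of_ne hk]; exact hp.even k
  · intro k
    by_cases hk : k = i
    · subst hk; simp only [Function.update_self]; omega
    · rw [Function.update_of_ne hk]; exact hp.nonneg k
  · intro k
    by_cases hk : k = i
    · subst hk; simp only [Function.update_self]; rw [← hi2]; exact hp.le_top k
    · rw [Function.update_of_ne hk]; exact hp.le_top k
  · intro k
    by_cases hk : k = i
    · subst hk; simp only [Function.update_self]
      intro hb0
      exact hstart (by omega)
    · rw [Function.update_of_ne hk]; exact hp.start k
  · intro k
    by_cases hk : k = i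
    · subst hk; simp only [Function.update_self]
      right; left
      exact ⟨trivial, le_rfl⟩
    · rw [Function.update_of_ne hk]
      have h1 := hp.location k
      have := hloc k hk
      omega
  · intro k hk
    have hki : k ≠ i := by
      rintro rfl
      have := hp.initial k (by omega)
      clear hstart
      simp only [rowEnd] at *
      omega
    rw [Function.update_of_ne hki]
    exact hp.initial k (by omega)

theorem IsPathState.skip {x u n : ℕ} {h : Fin n → ℕ} {p : Fin n → ℤ × ℤ} {j b : ℤ}
    (hp : IsPathState x u h p j b) (hpar : Even (b + j)) (hfree : ∀ k, p k ≠ (b, j)) :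
    IsPathState x u h p j (b - 2) where
  lex := hp.lex
  even := hp.even
  nonneg := hp.nonneg
  le_top := hp.le_top
  start := hp.start
  location k := by
    have h1 := hp.location k
    have h2 : (p k).1 ≠ b ∨ (p k).2 ≠ j := by
      by_contra hcon
      push Not at hcon
      exact hfree k (Prod.ext hcon.1 hcon.2)
    have h3 := hp.even k
    rw [Int.even_iff] at h3 hpar
    omega
  initial k hk := hp.initial k (by omega)

theorem IsPathState.next_row {x u n : ℕ} {h : Fin n → ℕ} {p : Fin n → ℤ × ℤ} {j b : ℤ}
    (hp : IsPathState x u h p j b) (hb : b ≤ 0) :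
    IsPathState x u h p (j + 1) (rowEnd x u n (j + 1)) where
  lex := hp.lex
  even := hp.even
  nonneg := hp.nonneg
  le_top := hp.le_top
  start := hp.start
  location k := by
    have h0 := hp.nonneg k
    have h1 := hp.location k
    have h2 := hp.le_top k
    have h3 := k.2
    simp only [rowEnd] at *
    omega
  initial k hk := hp.initial k (by omega)

/-! ### From tilings to a determinant of path generating functions -/

section
variable {K : Type*}

/-- The matrix of the path generating functions for the positions `p`. -/
def pathMatrix {n : ℕ} (F : Fin n → ℤ → ℤ → K) (p : Fin n → ℤ × ℤ) : Matrix (Fin n) (Fin n) K :=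
  Matrix.of fun k i => F i (p k).1 (p k).2

theorem pathMatrix_update {n : ℕ} (F : Fin n → ℤ → ℤ → K) (p : Fin n → ℤ × ℤ) (k : Fin n)
    (v : ℤ × ℤ) :
    pathMatrix F (Function.update p k v) =
      (pathMatrix F p).updateRow k (fun i => F i v.1 v.2) := by
  ext k' i
  by_cases hk : k' = k
  · subst hk
    simp [pathMatrix]
  · simp [pathMatrix, hk]

variable [Field K]

/-- `F i` behaves like the generating function of the lattice paths that start on the west side
at height `2 hᵢ` and are made of down steps weighted by `wt₂` and of horizontal steps. -/
structure IsPathGF (q : K) {n : ℕ} (h : Fin n → ℕ) (F : Fin n → ℤ → ℤ → K) : Prop where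
  step : ∀ i b j, 1 ≤ b → Even (b + j) →
    F i b j = wt₂ q ((b - 1, j + 1), .vertical) * F i (b - 1) (j + 1) + F i (b - 2) j
  neg : ∀ i b j, b < 0 → F i b j = 0
  above : ∀ i b j, 2 * (h i : ℤ) < j → F i b j = 0
  zero : ∀ i j, j ≠ 2 * (h i : ℤ) → F i 0 j = 0
  one : ∀ i, F i 0 (2 * (h i : ℤ)) = 1

theorem det_pathMatrix_eq_add {n : ℕ} {q : K} {h : Fin n → ℕ} {F : Fin n → ℤ → ℤ → K}
    (hF : IsPathGF q h F) (p : Fin n → ℤ × ℤ) {k : Fin n} {b j : ℤ} (hk : p k = (b, j))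
    (hb : 1 ≤ b) (hpar : Even (b + j)) :
    (pathMatrix F p).det =
      wt₂ q ((b - 1, j + 1), .vertical) *
          (pathMatrix F (Function.update p k (b - 1, j + 1))).det +
        (pathMatrix F (Function.update p k (b - 2, j))).det := by
  rw [pathMatrix_update, pathMatrix_update, ← Matrix.det_updateRow_smul,
    ← Matrix.det_updateRow_add]
  congr 1
  ext k' i
  by_cases hk' : k' = k
  · subst hk'
    simp [pathMatrix, hk, hF.step i b j hb hpar]
  · simp [hk']

theorem mem_remainingRegion {R : Finset UnitTriangle} {n : ℕ} {p : Fin n → ℤ × ℤ}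
    {j b a c : ℤ} :
    (a, c) ∈ remainingRegion R p j b ↔
      (a, c) ∈ R ∧ (j < c ∨ c = j ∧ a ≤ b) ∧ ∀ k, p k ≠ (a, c) := by
  simp [remainingRegion]

theorem remainingRegion_update {R : Finset UnitTriangle} {n : ℕ} {p : Fin n → ℤ × ℤ}
    {j b : ℤ} {i : Fin n} (hi : p i = (b, j)) (v : ℤ × ℤ) :
    remainingRegion R (Function.update p i v) j (b - 2) =
      remainingRegion R p j b \ {(b - 1, j), v} := by
  obtain ⟨v1, v2⟩ := v
  ext ⟨a, c⟩
  rw [mem_sdiff, mem_remainingRegion, mem_remainingRegion,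
    Function.forall_update_iff p (p := fun _ y => y ≠ (a, c))]
  simp only [mem_insert, mem_singleton, Prod.mk.injEq, not_or, ne_eq]
  constructor
  · rintro ⟨h1, h2, h3, h4⟩
    refine ⟨⟨h1, by omega, fun k => ?_⟩, by omega, by omega⟩
    by_cases hk : k = i
    · subst hk
      rw [hi, Prod.mk.injEq]
      omega
    · exact h4 k hk
  · rintro ⟨⟨h1, h2, h3⟩, h4, h5⟩
    have := h3 i
    rw [hi, Prod.mk.injEq] at this
    exact ⟨h1, by omega, by omega, fun k _ => h3 k⟩

theorem remainingRegion_skip {R : Finset UnitTriangle} {n : ℕ} (p : Fin n → ℤ × ℤ)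
    (j b : ℤ) :
    remainingRegion R p j (b - 2) = remainingRegion R p j b \ {(b, j), (b - 1, j)} := by
  ext ⟨a, c⟩
  rw [mem_sdiff, mem_remainingRegion, mem_remainingRegion]
  simp only [mem_insert, mem_singleton, Prod.mk.injEq, not_or, ne_eq]
  constructor
  · rintro ⟨h1, h2, h3⟩
    exact ⟨⟨h1, by omega, h3⟩, by omega, by omega⟩
  · rintro ⟨⟨h1, h2, h3⟩, h4, h5⟩
    exact ⟨h1, by omega, h3⟩

variable {q : K} {x u n : ℕ} {h : Fin n → ℕ} {F : Fin n → ℤ → ℤ → K}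

theorem tilingGF_remainingRegion_step (hF : IsPathGF q h F)
    (hmem : ∀ i, 1 ≤ h i ∧ h i ≤ u) {j b : ℤ} (hj0 : 0 ≤ j)
    (hju : j ≤ 2 * u) (hb1 : 1 ≤ b) (hb : b ≤ rowEnd x u n j) (hpar : Even (b + j))
    (ih : ∀ p, IsPathState x u h p j (b - 2) →
      tilingGF (remainingRegion (regionD x u h) p j (b - 2)) (wt₂ q) = (pathMatrix F p).det)
    (p : Fin n → ℤ × ℤ) (hp : IsPathState x u h p j b) :
    tilingGF (remainingRegion (regionD x u h) p j b) (wt₂ q) = (pathMatrix F p).det := by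
  have hpar' := Int.even_iff.1 hpar
  have hdR : (b - 1, j) ∈ regionD x u h := by
    rw [mem_regionD]
    simp only [rowEnd] at hb
    refine ⟨by omega, hj0, hju, by omega, by omega, by omega, fun h1 h2 => ?_⟩
    rw [Int.even_iff] at h2
    omega
  by_cases hex : ∃ i, p i = (b, j)
  · obtain ⟨i, hi⟩ := hex
    have hd : (b - 1, j) ∈ remainingRegion (regionD x u h) p j b := by
      rw [mem_remainingRegion]
      refine ⟨hdR, by omega, fun k hk => ?_⟩
      have := hp.even k
      rw [hk, Int.even_iff] at this
      simp only at this
      omega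
    have hc : (b - 1 + 1, j) ∉ remainingRegion (regionD x u h) p j b := by
      rw [mem_remainingRegion]
      rintro ⟨_, _, h3⟩
      exact h3 i (by rw [hi]; congr 1; ring)
    rw [tilingGF_of_down q (by rw [Int.even_iff]; omega) hd hc,
      det_pathMatrix_eq_add hF p hi hb1 hpar,
      show b - 1 - 1 = b - 2 by ring, ← remainingRegion_update hi, ← remainingRegion_update hi]
    congr 1
    · split_ifs with hin
      · congr 1
        refine ih _ (hp.shift_up hb hb1 hi ?_ fun hb0 => ?_)
        · have := (mem_regionD.1 (mem_remainingRegion.1 hin).1)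
          omega
        · have := (mem_regionD.1 (mem_remainingRegion.1 hin).1)
          exact this.2.2.2.2.2.2 (by omega) (by rw [Int.even_iff]; omega)
      · symm
        rw [mul_eq_zero]
        right
        refine Matrix.det_eq_zero_of_row_eq_zero i fun i' => ?_
        rw [pathMatrix_update, Matrix.updateRow_self]
        simp only
        -- The upward step is blocked by a dent or by the top side; in both cases the new row of the
        -- matrix vanishes.
        by_cases htop : j + 1 ≤ 2 * u
        · have hnot : (b - 1, j + 1) ∉ regionD x u h := fun hcon =>
            hin (mem_remainingRegion.2 ⟨hcon, by omega, hp.not_mem_shift hb⟩)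
          rw [mem_regionD] at hnot
          have hb0 : b - 1 = 0 := by
            by_contra hne
            refine hnot ⟨by omega, by omega, by omega, by omega, ?_, ?_, fun h1 => absurd h1 hne⟩
            all_goals simp only [rowEnd] at hb; omega
          rw [hb0]
          refine hF.zero i' _ fun hcon => hnot ⟨by omega, by omega, by omega, by omega, ?_, ?_,
            fun _ _ => ⟨i', hcon⟩⟩
          all_goals simp only [rowEnd] at hb; omega
        · refine hF.above i' _ _ ?_
          have := hmem i'
          omega
    · split_ifs with hin
      · have hin' := mem_remainingRegion.1 hin
        have hin'' := mem_regionD.1 hin'.1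
        exact ih _ (hp.shift_left hb (by omega) hi hin'.2.2 fun hb0 =>
          hin''.2.2.2.2.2.2 (by omega) (by rw [Int.even_iff]; omega))
      · symm
        -- A leftward step onto another head produces two equal rows; this is where non-intersection
        -- is enforced.
        by_cases hcol : ∃ k, p k = (b - 2, j)
        · obtain ⟨k, hk⟩ := hcol
          have hne : i ≠ k := by
            rintro rfl
            rw [hi, Prod.mk.injEq] at hk
            omega
          refine Matrix.det_zero_of_row_eq hne ?_
          ext i'
          simp [pathMatrix, hk, hne.symm]
        · push Not at hcol
          refine Matrix.det_eq_zero_of_row_eq_zero i fun i' => ?_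
          rw [pathMatrix_update, Matrix.updateRow_self]
          simp only
          have hnot : (b - 2, j) ∉ regionD x u h := fun hcon =>
            hin (mem_remainingRegion.2 ⟨hcon, by omega, hcol⟩)
          rw [mem_regionD] at hnot
          rcases lt_trichotomy (b - 2) 0 with hneg | hb0 | hpos
          · exact hF.neg _ _ _ hneg
          · rw [hb0]
            refine hF.zero i' _ fun hcon => hnot ⟨by omega, by omega, by omega, ?_, ?_, ?_,
              fun _ _ => ⟨i', hcon⟩⟩
            · have := hmem i'
              omega
            all_goals simp only [rowEnd] at hb; omega
          · exfalso
            refine hnot ⟨by omega, by omega, by omega, by omega, ?_, ?_,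
              fun h1 => absurd h1 hpos.ne'⟩
            all_goals simp only [rowEnd] at hb; omega
  · push Not at hex
    rw [← ih p (hp.skip hpar hex), remainingRegion_skip]
    -- When `j < n`, the sweep of row `j` starts just outside the region, at the initial position of
    -- path `j`. That position is occupied, so an unoccupied `(b, j)` lies inside the region.
    have hjn : 2 * (x : ℤ) + 2 * u - 2 * n + 2 + j ≤ b → ¬ j < n := by
      intro h1 h2
      have := hp.initial ⟨j.toNat, by omega⟩ (by simp only; omega)
      refine hex ⟨j.toNat, by omega⟩ (Prod.ext ?_ ?_)
      · rw [this.1]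
        simp only [rowEnd] at *
        omega
      · rw [this.2]
        simp only
        omega
    refine tilingGF_of_up_forced q hpar ?_ ?_ ?_ ?_
    · rw [mem_remainingRegion, mem_regionD]
      simp only [rowEnd] at hb
      refine ⟨⟨by omega, by omega, by omega, by omega, by omega, by omega, ?_⟩, by omega, hex⟩
      omega
    · rw [mem_remainingRegion]
      omega
    · rw [mem_remainingRegion]
      omega
    · rw [mem_remainingRegion]
      refine ⟨hdR, by omega, fun k hk => ?_⟩
      have := hp.even k
      rw [hk, Int.even_iff] at this
      simp only at this
      omega

/-- If the up-pointing triangle of an undented bump is still uncovered at the end of its row, it has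
no partner and there is no tiling. Correspondingly the column of that bump is zero: each head is at
another point of the axis or strictly above row `j`. Otherwise nothing of row `j` remains. -/
theorem tilingGF_remainingRegion_row_finish (hF : IsPathGF q h F) {j b : ℤ} (hj0 : 0 ≤ j)
    (hju : j ≤ 2 * u) (hb0 : b ≤ 0) (hb1 : -1 ≤ b) (hpar : Even (b + j))
    (ih : ∀ p, IsPathState x u h p (j + 1) (rowEnd x u n (j + 1)) →
      tilingGF (remainingRegion (regionD x u h) p (j + 1) (rowEnd x u n (j + 1))) (wt₂ q) =
        (pathMatrix F p).det)
    (p : Fin n → ℤ × ℤ) (hp : IsPathState x u h p j b) :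
    tilingGF (remainingRegion (regionD x u h) p j b) (wt₂ q) = (pathMatrix F p).det := by
  have hpar' := Int.even_iff.1 hpar
  by_cases hstuck : (b, j) ∈ remainingRegion (regionD x u h) p j b
  · have hst := mem_remainingRegion.1 hstuck
    have hst' := mem_regionD.1 hst.1
    have hb : b = 0 := by omega
    subst hb
    obtain ⟨i, hi⟩ := hst'.2.2.2.2.2.2 rfl (by rw [Int.even_iff]; omega)
    rw [tilingGF_of_up_isolated _ hpar hstuck, Matrix.det_eq_zero_of_column_eq_zero i]
    · intro k
      have h0 := hp.nonneg k
      have h1 : ¬ ((p k).1 = 0 ∧ (p k).2 = j) := fun hcon => hst.2.2 k (Prod.ext hcon.1 hcon.2)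
      simp only [pathMatrix, Matrix.of_apply]
      by_cases h2 : (p k).2 ≤ j
      · have h3 : (p k).1 = 0 := by
          have := hp.location k
          have := k.2
          omega
        rw [h3]
        exact hF.zero i _ (by omega)
      · exact hF.above i _ _ (by omega)
    all_goals rw [mem_remainingRegion, mem_regionD]; omega
  · rw [← ih p (hp.next_row hb0)]
    congr 1
    ext ⟨a, c⟩
    rw [mem_remainingRegion, mem_remainingRegion]
    constructor
    · rintro ⟨h1, h2, h3⟩
      have h4 := mem_regionD.1 h1
      have h5 : ¬ (b = a ∧ c = j) := by
        rintro ⟨rfl, rfl⟩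
        exact hstuck (mem_remainingRegion.2 ⟨h1, h2, h3⟩)
      simp only [rowEnd]
      refine ⟨h1, ?_, h3⟩
      have h6 : j < c := by omega
      rcases lt_or_eq_of_le (Int.add_one_le_iff.2 h6) with h7 | h7
      · exact Or.inl h7
      · exact Or.inr ⟨h7.symm, by omega⟩
    · rintro ⟨h1, h2, h3⟩
      exact ⟨h1, by omega, h3⟩

theorem tilingGF_remainingRegion_row (hF : IsPathGF q h F)
    (hmem : ∀ i, 1 ≤ h i ∧ h i ≤ u) {j : ℤ} (hj0 : 0 ≤ j) (hju : j ≤ 2 * u)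
    (ih : ∀ p, IsPathState x u h p (j + 1) (rowEnd x u n (j + 1)) →
      tilingGF (remainingRegion (regionD x u h) p (j + 1) (rowEnd x u n (j + 1))) (wt₂ q) =
        (pathMatrix F p).det) (s : ℕ) :
    ∀ b : ℤ, b = s - 1 → b ≤ rowEnd x u n j → Even (b + j) → ∀ p, IsPathState x u h p j b →
      tilingGF (remainingRegion (regionD x u h) p j b) (wt₂ q) = (pathMatrix F p).det := by
  induction s using Nat.strong_induction_on with
  | _ s hs =>
    intro b hbs hb hpar p hp
    by_cases hb1 : b ≤ 0
    · exact tilingGF_remainingRegion_row_finish hF hj0 hju hb1 (by omega) hpar ih p hp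
    · refine tilingGF_remainingRegion_step hF hmem hj0 hju (by omega) hb hpar ?_ p hp
      refine hs (s - 2) (by omega) (b - 2) (by omega) (by omega) ?_
      rw [Int.even_iff] at *
      omega

theorem tilingGF_remainingRegion_top (hF : IsPathGF q h F) (hmono : StrictMono h) {j b : ℤ}
    (hj : 2 * (u : ℤ) < j) (hnu : n ≤ u) (p : Fin n → ℤ × ℤ) (hp : IsPathState x u h p j b) :
    tilingGF (remainingRegion (regionD x u h) p j b) (wt₂ q) = (pathMatrix F p).det := by
  have h0 : remainingRegion (regionD x u h) p j b = ∅ := by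
    refine eq_empty_of_forall_notMem ?_
    rintro ⟨a, c⟩ hac
    have h1 := mem_remainingRegion.1 hac
    have h2 := mem_regionD.1 h1.1
    omega
  have h1 : ∀ k, (p k).1 = 0 := by
    intro k
    have := hp.location k
    have := hp.le_top k
    have := k.2
    omega
  choose σ hσ using fun k => hp.start k (h1 k)
  have hσmono : StrictMono σ := by
    intro k k' hkk
    have := hp.lex k k' hkk
    rw [h1, h1, hσ, hσ] at this
    refine hmono.lt_iff_lt.1 ?_
    omega
  -- The order of the heads is preserved, so the assignment of paths to bumps is a strictly
  -- increasing self-map of `Fin n`, hence the identity. No sign appears.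
  have hσid : ∀ k, σ k = k := fun k => by
    refine le_antisymm ?_ hσmono.le_apply
    have h2 : StrictMono fun k : Fin n => (σ k.rev).rev := fun a b hab =>
      Fin.rev_lt_rev.2 (hσmono (Fin.rev_lt_rev.2 hab))
    have h3 := h2.le_apply (x := k.rev)
    simp only [Fin.rev_rev] at h3
    exact Fin.rev_le_rev.1 h3
  rw [h0, tilingGF_empty]
  symm
  convert Matrix.det_one (n := Fin n) (R := K)
  ext k i
  simp only [pathMatrix, Matrix.of_apply, h1, hσ, hσid, Matrix.one_apply]
  split_ifs with hki
  · rw [hki, hF.one]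
  · refine hF.zero _ _ fun hcon => hki (hmono.injective ?_)
    omega

/-- The tiling generating function as a determinant of path generating functions. -/
theorem tilingGF_regionD_eq_det (hF : IsPathGF q h F) (hmono : StrictMono h) (hnu : n ≤ u)
    (hmem : ∀ i, 1 ≤ h i ∧ h i ≤ u) :
    tilingGF (regionD x u h) (wt₂ q) =
      (Matrix.of fun (k i : Fin n) =>
        F i (2 * (x : ℤ) + 2 * u - 2 * n + 2 + (k : ℕ)) (k : ℕ)).det := by
  -- `s` is the number of rows left; `s = 0` is the empty row just above the region.
  have key : ∀ s : ℕ, ∀ j : ℤ, j = 2 * u + 1 - s → 0 ≤ j →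
      ∀ p, IsPathState x u h p j (rowEnd x u n j) →
      tilingGF (remainingRegion (regionD x u h) p j (rowEnd x u n j)) (wt₂ q) =
        (pathMatrix F p).det := by
    intro s
    induction s with
    | zero =>
      intro j hj _ p hp
      exact tilingGF_remainingRegion_top hF hmono (by omega) hnu p hp
    | succ s ihs =>
      intro j hj hj0 p hp
      refine tilingGF_remainingRegion_row hF hmem hj0 (by omega)
        (ihs (j + 1) (by push_cast at hj; omega) (by omega)) (rowEnd x u n j + 1).toNat
        _ ?_ le_rfl ?_ p hp
      · simp only [rowEnd]
        omega
      · simp only [rowEnd, Int.even_iff]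
        omega
  have hp : IsPathState x u h
      (fun k : Fin n => (2 * (x : ℤ) + 2 * u - 2 * n + 2 + (k : ℕ), ((k : ℕ) : ℤ))) 0
      (rowEnd x u n 0) := by
    constructor
    · intro k k' hkk
      left
      simp only
      omega
    · intro k
      simp only [Int.even_iff]
      omega
    · intro k
      simp only
      omega
    · intro k
      have := k.2
      simp only
      omega
    · intro k hk
      simp only at hk
      omega
    · intro k
      have := k.2
      by_cases hk : (k : ℕ) = 0
      · right; left
        simp only [rowEnd]
        omega
      · right; right; right
        exact ⟨by omega, rfl, rfl⟩
    · intro k _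
      exact ⟨rfl, rfl⟩
  have h1 := key (2 * u + 1) 0 (by push_cast; omega) le_rfl _ hp
  rw [pathMatrix] at h1
  rw [← h1]
  congr 1
  ext ⟨a, c⟩
  rw [mem_remainingRegion]
  constructor
  · intro hac
    have h2 := mem_regionD.1 hac
    refine ⟨hac, ?_, fun k hk => ?_⟩
    · simp only [rowEnd]
      omega
    · rw [Prod.mk.injEq] at hk
      omega
  · exact fun hac => hac.1

end

/-! ### Symmetric q-integers and the closed form for one path -/

section
variable {K : Type*} [Field K]

/-- The symmetric `q`-integer `(q ^ k - q ^ (-k)) / (q - q⁻¹)`, written as a Laurent polynomial. -/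
def symInt (q : K) : ℤ → K
  | Int.ofNat k => q ^ (1 - (k : ℤ)) * qInt (q ^ 2) k
  | Int.negSucc k => -(q ^ (-(k : ℤ)) * qInt (q ^ 2) (k + 1))

theorem symInt_natCast (q : K) (k : ℕ) : symInt q k = q ^ (1 - (k : ℤ)) * qInt (q ^ 2) k := rfl

theorem symInt_zero (q : K) : symInt q 0 = 0 := by
  rw [← Nat.cast_zero, symInt_natCast]
  simp [qInt]

theorem symInt_neg (q : K) (k : ℤ) : symInt q (-k) = -symInt q k := by
  have h1 : ∀ m : ℕ, symInt q (-((m : ℤ) + 1)) = -symInt q ((m : ℤ) + 1) := by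
    intro m
    have : (-((m : ℤ) + 1)) = Int.negSucc m := by rw [Int.negSucc_eq]
    rw [this, ← Nat.cast_succ, symInt_natCast]
    simp [symInt]
  rcases lt_trichotomy k 0 with hk | rfl | hk
  · obtain ⟨m, hm⟩ := Int.eq_ofNat_of_zero_le (show 0 ≤ -k - 1 by omega)
    have : k = -((m : ℤ) + 1) := by omega
    rw [this, h1]
    simp
  · simp [symInt_zero]
  · obtain ⟨m, hm⟩ := Int.eq_ofNat_of_zero_le (show 0 ≤ k - 1 by omega)
    have : k = (m : ℤ) + 1 := by omega
    rw [this, h1]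

variable {q : K}

theorem qInt_eq_symInt (hq0 : q ≠ 0) (k : ℕ) :
    qInt (q ^ 2) k = q ^ ((k : ℤ) - 1) * symInt q k := by
  rw [symInt_natCast, ← mul_assoc, ← zpow_add₀ hq0]
  simp

theorem symInt_add_one (hq0 : q ≠ 0) (k : ℤ) :
    symInt q (k + 1) = q * symInt q k + q ^ (-k) := by
  have h1 : ∀ m : ℕ, symInt q ((m : ℤ) + 1) = q * symInt q m + q ^ (-(m : ℤ)) := by
    intro m
    have h2 : qInt (q ^ 2) (m + 1) = q ^ 2 * qInt (q ^ 2) m + 1 := by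
      rw [qInt, sum_range_succ', qInt, mul_sum]
      simp [pow_succ']
    rw [← Nat.cast_succ, symInt_natCast, symInt_natCast, Nat.succ_eq_add_one, h2]
    have h3 : q ^ (1 - ((m + 1 : ℕ) : ℤ)) = q ^ (-(m : ℤ)) := by congr 1; push_cast; ring
    have h4 : q ^ (1 - (m : ℤ)) = q ^ (-(m : ℤ)) * q := by
      rw [← zpow_add_one₀ hq0]; congr 1; ring
    rw [h3, h4]
    ring
  have h1' : ∀ m : ℕ, q * symInt q ((m : ℤ) + 1) = symInt q m + q ^ ((m : ℤ) + 1) := by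
    intro m
    have h2 : qInt (q ^ 2) (m + 1) = qInt (q ^ 2) m + q ^ (2 * m) := by
      rw [qInt, sum_range_succ, qInt, ← pow_mul]
    rw [← Nat.cast_succ, symInt_natCast, symInt_natCast, Nat.succ_eq_add_one, h2]
    have h3 : q ^ (1 - ((m + 1 : ℕ) : ℤ)) = (q ^ (m : ℤ))⁻¹ := by
      rw [← zpow_neg]; congr 1; push_cast; ring
    have h4 : q ^ (1 - (m : ℤ)) = (q ^ (m : ℤ))⁻¹ * q := by
      rw [← zpow_neg, ← zpow_add_one₀ hq0]; congr 1; ring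
    have h5 : q ^ (((m + 1 : ℕ) : ℤ)) = q ^ (m : ℤ) * q := by
      rw [← zpow_add_one₀ hq0]; congr 1
    have h6 : q ^ (2 * m) = q ^ (m : ℤ) * q ^ (m : ℤ) := by
      rw [zpow_natCast, ← pow_add]; congr 1; ring
    have h7 : q ^ (m : ℤ) ≠ 0 := zpow_ne_zero _ hq0
    rw [h3, h4, h5, h6]
    field_simp
  rcases le_or_gt 0 k with hk | hk
  · obtain ⟨m, rfl⟩ := Int.eq_ofNat_of_zero_le hk
    exact h1 m
  · obtain ⟨m, hm⟩ := Int.eq_ofNat_of_zero_le (show 0 ≤ -k - 1 by omega)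
    have hk' : k = -((m : ℤ) + 1) := by omega
    rw [show k + 1 = -(m : ℤ) by omega, hk', symInt_neg, symInt_neg, mul_neg, h1', neg_neg]
    ring

theorem symInt_one (hq0 : q ≠ 0) : symInt q 1 = 1 := by
  have := symInt_add_one hq0 0
  simpa [symInt_zero] using this

/-- Induction on `a` replaces the quotient formula, which would require $q^2\ne1$. -/
theorem symInt_add (hq0 : q ≠ 0) (a b : ℤ) :
    symInt q (a + b) = q ^ a * symInt q b + q ^ (-b) * symInt q a := by
  have hz : ∀ m : ℤ, q ^ (m + 1) = q * q ^ m := fun m => by rw [zpow_add_one₀ hq0, mul_comm]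
  have key : ∀ a b : ℤ, symInt q (a + b) = q ^ a * symInt q b + q ^ (-b) * symInt q a ↔
      symInt q (a + 1 + b) = q ^ (a + 1) * symInt q b + q ^ (-b) * symInt q (a + 1) := by
    intro a b
    have h1 : q ^ (-(a + b)) = q ^ (-b) * q ^ (-a) := by rw [← zpow_add₀ hq0]; congr 1; ring
    rw [show a + 1 + b = (a + b) + 1 by ring, symInt_add_one hq0, symInt_add_one hq0, hz, h1,
      show q * q ^ a * symInt q b + q ^ (-b) * (q * symInt q a + q ^ (-a)) =
        q * (q ^ a * symInt q b + q ^ (-b) * symInt q a) + q ^ (-b) * q ^ (-a) by ring]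
    rw [add_left_inj]
    exact (mul_right_inj' hq0).symm
  induction a using Int.induction_on with
  | zero => simp [symInt_zero]
  | succ m ih => exact (key m b).1 ih
  | pred m ih =>
    refine (key _ b).2 ?_
    simpa using ih

theorem symInt_two_mul (hq0 : q ≠ 0) (k : ℤ) :
    symInt q (2 * k) = (q ^ k + q ^ (-k)) * symInt q k := by
  rw [two_mul, symInt_add hq0]
  ring

theorem symInt_mul_sub_mul (hq0 : q ≠ 0) (a b t : ℤ) :
    symInt q (a + t) * symInt q (b + t) - symInt q a * symInt q b =
      symInt q t * symInt q (a + b + t) := by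
  have h1 : q ^ t * q ^ (-t) = 1 := by rw [← zpow_add₀ hq0]; simp
  rw [show a + b + t = (a + t) + b by ring, symInt_add hq0 (a + t) b, symInt_add hq0 a t,
    add_comm b t, symInt_add hq0 t b, zpow_add₀ hq0 a t]
  linear_combination (symInt q a * symInt q b) * h1

theorem symInt_add_one_sub (hq0 : q ≠ 0) (k : ℤ) :
    symInt q (k + 1) - symInt q (k - 1) = q ^ k + q ^ (-k) := by
  rw [sub_eq_add_neg k, symInt_add hq0, symInt_add hq0, symInt_neg, symInt_one hq0, neg_neg,
    zpow_neg_one, zpow_one]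
  have h2 := symInt_add_one hq0 k
  rw [symInt_add hq0, symInt_one hq0, zpow_neg_one] at h2
  linear_combination h2

theorem symInt_ne_zero (hq0 : q ≠ 0) (hq : ∀ k : ℕ, 1 ≤ k → qInt (q ^ 2) k ≠ 0) {k : ℤ}
    (hk : k ≠ 0) : symInt q k ≠ 0 := by
  have h1 : ∀ m : ℕ, 1 ≤ m → symInt q m ≠ 0 := fun m hm =>
    mul_ne_zero (zpow_ne_zero _ hq0) (hq m hm)
  rcases lt_or_gt_of_ne hk with h | h
  · obtain ⟨m, hm⟩ := Int.eq_ofNat_of_zero_le (show 0 ≤ -k by omega)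
    rw [← neg_neg k, symInt_neg, hm]
    exact neg_ne_zero.2 (h1 m (by omega))
  · obtain ⟨m, hm⟩ := Int.eq_ofNat_of_zero_le h.le
    rw [hm]
    exact h1 m (by omega)

/-- The generating function of the paths with `d` down steps from the `j`-axis to abscissa `b`. -/
def axisPathGF (q : K) : ℕ → ℤ → K
  | 0, _ => 1
  | d + 1, b => (2 ^ (d + 1))⁻¹ * (symInt q b * ∏ i ∈ range d, symInt q (b + d - 1 - 2 * i)) /
      ∏ i ∈ range (d + 1), symInt q ((i : ℤ) + 1)

theorem axisPathGF_succ (q : K) (d : ℕ) (b : ℤ) : axisPathGF q (d + 1) b =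
    (2 ^ (d + 1))⁻¹ * (symInt q b * ∏ i ∈ range d, symInt q (b + d - 1 - 2 * i)) /
      ∏ i ∈ range (d + 1), symInt q ((i : ℤ) + 1) := rfl

theorem axisPathGF_one (hq0 : q ≠ 0) (b : ℤ) : axisPathGF q 1 b = symInt q b / 2 := by
  simp [axisPathGF, symInt_one hq0]
  ring

theorem axisPathGF_zero_right (q : K) (d : ℕ) : axisPathGF q (d + 1) 0 = 0 := by
  simp [axisPathGF, symInt_zero]

theorem axisPathGF_eq_zero (q : K) {d m : ℕ} (hm : m < d) {b : ℤ} (hb : b + d - 1 = 2 * m) :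
    axisPathGF q (d + 1) b = 0 := by
  rw [axisPathGF_succ, prod_eq_zero (mem_range.2 hm)]
  · simp
  · rw [hb, sub_self, symInt_zero]

/-- After the common factors are removed, the recursion for $d+2$ down steps is
$[b][b+d]-[b-2][b-2-d]=[d+2][2(b-1)]$, together with $[2(b-1)]=(q^{b-1}+q^{-(b-1)})[b-1]$. -/
theorem axisPathGF_step [CharZero K] (hq0 : q ≠ 0)
    (hq : ∀ k : ℕ, 1 ≤ k → qInt (q ^ 2) k ≠ 0) (d : ℕ) (b : ℤ) :
    axisPathGF q (d + 1) b =
      (q ^ (b - 1) + q ^ (-(b - 1))) / 2 * axisPathGF q d (b - 1) +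
        axisPathGF q (d + 1) (b - 2) := by
  cases d with
  | zero =>
    rw [axisPathGF_one hq0, axisPathGF_one hq0]
    have := symInt_add_one_sub hq0 (b - 1)
    rw [sub_add_cancel, show b - 1 - 1 = b - 2 by ring] at this
    simp only [axisPathGF]
    linear_combination this / 2
  | succ d =>
    rw [axisPathGF_succ, axisPathGF_succ, axisPathGF_succ, prod_range_succ _ (d + 1),
      prod_range_succ' (fun i : ℕ => symInt q (b + (d + 1 : ℕ) - 1 - 2 * i)),
      prod_range_succ (fun i : ℕ => symInt q (b - 2 + (d + 1 : ℕ) - 1 - 2 * i))]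
    have e1 : ∀ i ∈ range d, symInt q (b + (d + 1 : ℕ) - 1 - 2 * (i + 1 : ℕ)) =
        symInt q (b - 1 + d - 1 - 2 * i) := fun i _ => by congr 1; push_cast; ring
    have e2 : ∀ i ∈ range d, symInt q (b - 2 + (d + 1 : ℕ) - 1 - 2 * i) =
        symInt q (b - 1 + d - 1 - 2 * i) := fun i _ => by congr 1; push_cast; ring
    rw [prod_congr rfl e1, prod_congr rfl e2]
    set P := ∏ i ∈ range d, symInt q (b - 1 + d - 1 - 2 * i)
    have h1 := symInt_mul_sub_mul hq0 (b - 2 - d) (b - 2) (d + 2)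
    have h2 := symInt_two_mul hq0 (b - 1)
    rw [show b - 2 - d + (d + 2) = b by ring, show b - 2 + ((d : ℤ) + 2) = b + d by ring,
      show b - 2 - d + (b - 2) + (d + 2) = 2 * (b - 1) by ring, h2] at h1
    have hD : ∏ i ∈ range (d + 1), symInt q ((i : ℤ) + 1) ≠ 0 :=
      prod_ne_zero_iff.2 fun i _ => symInt_ne_zero hq0 hq (by omega)
    have hD' : symInt q (((d + 1 : ℕ) : ℤ) + 1) ≠ 0 := symInt_ne_zero hq0 hq (by omega)
    have e3 : symInt q (((d + 1 : ℕ) : ℤ) + 1) = symInt q (d + 2) := by congr 1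
    have e4 : symInt q (b + (d + 1 : ℕ) - 1 - 2 * (0 : ℕ)) = symInt q (b + d) := by
      congr 1; push_cast; ring
    have e5 : symInt q (b - 2 + (d + 1 : ℕ) - 1 - 2 * (d : ℕ)) = symInt q (b - 2 - d) := by
      congr 1; push_cast; ring
    rw [e3] at hD' ⊢
    rw [e4, e5]
    field_simp
    linear_combination 2 ^ d * 4 * P * h1

/-- The generating function of the paths from height `2 h` on the `j`-axis to `(b, j)`. -/
def dentPathGF (q : K) (h : ℕ) (b j : ℤ) : K :=
  if b < 0 ∨ 2 * (h : ℤ) < j then 0 else axisPathGF q (2 * h - j).toNat b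

theorem isPathGF_dentPathGF [CharZero K] (hq0 : q ≠ 0)
    (hq : ∀ k : ℕ, 1 ≤ k → qInt (q ^ 2) k ≠ 0) {n : ℕ} (h : Fin n → ℕ) :
    IsPathGF q h fun i => dentPathGF q (h i) where
  neg i b j hb := by simp [dentPathGF, hb]
  above i b j hj := by simp [dentPathGF, hj]
  one i := by simp [dentPathGF, axisPathGF]
  zero i j hj := by
    unfold dentPathGF
    split_ifs with h1
    · rfl
    · obtain ⟨d, hd⟩ : ∃ d, (2 * (h i : ℤ) - j).toNat = d + 1 :=
        ⟨(2 * (h i : ℤ) - j).toNat - 1, by omega⟩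
      rw [hd, axisPathGF_zero_right]
  step i b j hb hpar := by
    rw [Int.even_iff] at hpar
    simp only [dentPathGF]
    rcases lt_trichotomy (2 * (h i : ℤ)) j with h1 | h1 | h1
    · rw [if_pos (by omega), if_pos (by omega), if_pos (by omega)]
      simp
    · rw [if_neg (by omega), if_pos (by omega), if_neg (by omega), ← h1]
      simp [axisPathGF]
    · obtain ⟨d, hd⟩ : ∃ d, (2 * (h i : ℤ) - j).toNat = d + 1 :=
        ⟨(2 * (h i : ℤ) - j).toNat - 1, by omega⟩
      have hd' : (2 * (h i : ℤ) - (j + 1)).toNat = d := by omega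
      rw [if_neg (by omega), if_neg (by omega), hd, hd']
      -- At `b = 1` the horizontal step would leave the lattice, so the general recursion is not
      -- available. With one down step left, the exceptional axis weight $1/2$ equals $[1]/2$. With
      -- more, both sides are 0, since by parity the closed form contains a factor $[0]$.
      rcases eq_or_lt_of_le hb with rfl | hb2
      · rw [if_pos (by omega)]
        cases d with
        | zero =>
          rw [axisPathGF_one hq0, symInt_one hq0]
          simp [wt₂, axisPathGF]
        | succ d =>
          rw [sub_self, axisPathGF_zero_right,
            axisPathGF_eq_zero q (m := (d + 1) / 2) (by omega) (by push_cast; omega)]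
          simp
      · rw [if_neg (by omega), axisPathGF_step hq0 hq]
        simp only [wt₂]
        rw [if_neg (by omega)]

end

/-! ### Evaluation of the determinant -/

section
variable {K : Type*} [Field K]

/-- In round `s`, the recursion writes each row `k > s` as `c s k` times the old row plus the old
row `k - 1`. Adding a multiple of the preceding row does not change the determinant, so the round
only contributes the factors `c s k`. -/
theorem det_eq_prod_mul_det_of_pascal_step {n : ℕ} (Φ : Fin n → ℕ → ℕ → K) (c : ℕ → ℕ → K)
    (hc : ∀ t k, t < k → c t k ≠ 0)
    (hΦ : ∀ i t k, t ≤ k → Φ i (t + 1) (k + 1) = c t (k + 1) * Φ i t (k + 1) + Φ i t k) :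
    (Matrix.of fun k i : Fin n => Φ i k k).det =
      (∏ k : Fin n, ∏ t ∈ range k, c t k) * (Matrix.of fun k i : Fin n => Φ i 0 k).det := by
  have key : ∀ s : ℕ, (Matrix.of fun k i : Fin n => Φ i (min s k) k).det =
      (∏ k : Fin n, ∏ t ∈ range (min s k), c t k) *
        (Matrix.of fun k i : Fin n => Φ i 0 k).det := by
    intro s
    induction s with
    | zero => simp
    | succ s ih =>
      set e : ℕ → K := fun k => if s < k then c s k else 1 with he
      have hes : ∀ k, s < k → e k = c s k := fun k hk => if_pos hk
      have hes' : ∀ k, k ≤ s → e k = 1 := fun k hk => if_neg (by omega)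
      have hprod : ∀ k, ∏ t ∈ range (min (s + 1) k), c t k =
          e k * ∏ t ∈ range (min s k), c t k := by
        intro k
        rcases lt_or_ge s k with hk | hk
        · rw [hes k hk, min_eq_left (by omega), min_eq_left hk.le, prod_range_succ, mul_comm]
        · rw [hes' k hk, min_eq_right (by omega), min_eq_right hk, one_mul]
      have h1 : (Matrix.of fun k i : Fin n => Φ i (min (s + 1) k) k).det =
          (Matrix.of fun k i : Fin n => e k * Φ i (min s k) k).det := by
        cases n with
        | zero => simp
        | succ n =>
          symm
          -- The preceding row is already scaled by `e k`; the coefficient `-(e k)⁻¹` undoes this.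
          refine Matrix.det_eq_of_forall_row_eq_smul_add_pred
            (fun k => if s ≤ (k : ℕ) then -(e k)⁻¹ else 0) ?_ ?_
          · intro i
            simp [hes']
          · intro k i
            simp only [Matrix.of_apply, Fin.val_succ, Fin.val_castSucc]
            split_ifs with hk
            · have hek : e k ≠ 0 := by
                rcases Nat.lt_or_ge s k with h | h
                · rw [hes _ h]; exact hc _ _ h
                · rw [hes' _ h]; exact one_ne_zero
              rw [hes _ (by omega), min_eq_left (by omega), min_eq_left (by omega),
                min_eq_left (by omega), hΦ _ _ _ hk]
              field_simp
              ring
            · rw [hes' _ (by omega), min_eq_right (by omega), min_eq_right (by omega)]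
              ring
      rw [h1]
      simp only [hprod]
      rw [prod_mul_distrib, mul_assoc, ← ih,
        ← Matrix.det_mul_column]
      rfl
  have h2 := key n
  have h3 : ∀ k : Fin n, min n (k : ℕ) = k := fun k => min_eq_right k.2.le
  simpa only [h3] using h2

theorem prod_Ioi_fin {n : ℕ} (i : Fin n) (f : ℕ → K) :
    ∏ j ∈ Ioi i, f j = ∏ l ∈ Ico ((i : ℕ) + 1) n, f l := by
  refine prod_bij' (fun j _ => (j : ℕ)) (fun l hl => ⟨l, (mem_Ico.1 hl).2⟩) ?_ ?_ ?_ ?_ ?_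
  · intro j hj
    rw [mem_Ioi] at hj
    rw [mem_Ico]
    exact ⟨hj, j.2⟩
  · intro l hl
    rw [mem_Ioi]
    exact (mem_Ico.1 hl).1
  · intros; rfl
  · intros; rfl
  · intros; rfl

/-- The entries of Krattenthaler's determinant in the variable `h`. -/
def crossEntry (q : K) (N : ℤ) (n k : ℕ) (h : ℤ) : K :=
  (∏ l ∈ range k, symInt q (2 * (N + l + h))) * ∏ l ∈ Ico (k + 1) n, symInt q (2 * (N + l - h))

-- By the addition formula every factor is a linear form in $v=[2h]$ and $w=q^{2h}$ with
-- coefficients free of $h$. There are $n-1$ factors, so the entry is $w^{n-1}$ times a polynomial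
-- of degree less than $n$ in $v/w$.
open Polynomial in
theorem crossEntry_eq_sum {q : K} (hq0 : q ≠ 0) (N : ℤ) {n : ℕ} (k : Fin n) :
    ∃ c : Fin n → K, ∀ h : ℤ, crossEntry q N n k h =
      ∑ m : Fin n, symInt q (2 * h) ^ (m : ℕ) * (q ^ (2 * h)) ^ (m.rev : ℕ) * c m := by
  set P : K[X] := (∏ l ∈ range k, (C (q ^ (-(2 * (N + l)))) * X + C (symInt q (2 * (N + l))))) *
    ∏ l ∈ Ico ((k : ℕ) + 1) n, (C (-q ^ (2 * (N + l))) * X + C (symInt q (2 * (N + l)))) with hP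
  have hdeg : P.natDegree < n := by
    have h1 : ∀ (s : Finset ℕ) (f g : ℕ → K),
        (∏ l ∈ s, (C (f l) * X + C (g l))).natDegree ≤ #s := fun s f g =>
      (natDegree_prod_le _ _).trans
        ((sum_le_card_nsmul _ _ 1 fun l _ => natDegree_linear_le).trans (by simp))
    have h2 := natDegree_mul_le_of_le
      (h1 (range k) (fun l => q ^ (-(2 * (N + l)))) (fun l => symInt q (2 * (N + l))))
      (h1 (Ico ((k : ℕ) + 1) n) (fun l => -q ^ (2 * (N + l))) (fun l => symInt q (2 * (N + l))))
    rw [card_range, Nat.card_Ico] at h2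
    have := k.2
    exact lt_of_le_of_lt h2 (by omega)
  refine ⟨fun m => P.coeff m, fun h => ?_⟩
  set v := symInt q (2 * h) with hv
  set w := q ^ (2 * h) with hw
  have hw0 : w ≠ 0 := zpow_ne_zero _ hq0
  have h1 : ∀ l : ℕ, symInt q (2 * (N + l + h)) =
      w * (q ^ (-(2 * (N + l))) * (v / w) + symInt q (2 * (N + l))) := by
    intro l
    rw [show 2 * (N + l + h) = 2 * h + 2 * (N + l) by ring, symInt_add hq0, ← hv, ← hw]
    field_simp
    ring
  have h2 : ∀ l : ℕ, symInt q (2 * (N + l - h)) =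
      w * (-q ^ (2 * (N + l)) * (v / w) + symInt q (2 * (N + l))) := by
    intro l
    rw [show 2 * (N + l - h) = 2 * (N + l) + -(2 * h) by ring, symInt_add hq0, neg_neg,
      symInt_neg, ← hv, ← hw]
    field_simp
  have h3 : crossEntry q N n k h = w ^ (n - 1) * P.eval (v / w) := by
    rw [crossEntry, prod_congr rfl fun l _ => h1 l, prod_congr rfl fun l _ => h2 l,
      prod_mul_distrib, prod_mul_distrib, prod_const, prod_const, card_range, Nat.card_Ico, hP,
      eval_mul, eval_prod, eval_prod]
    simp only [eval_add, eval_mul, eval_C, eval_X]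
    have : n - 1 = (k : ℕ) + (n - ((k : ℕ) + 1)) := by have := k.2; omega
    rw [this, pow_add]
    ring
  rw [h3, eval_eq_sum_range' hdeg, ← Fin.sum_univ_eq_sum_range (fun m => P.coeff m * (v / w) ^ m),
    mul_sum]
  refine sum_congr rfl fun m _ => ?_
  have : n - 1 = (m.rev : ℕ) + (m : ℕ) := by rw [Fin.val_rev]; have := m.2; omega
  rw [this, pow_add, div_pow]
  field_simp

/-- The matrix is a constant matrix times a homogeneous Vandermonde matrix in $([2h_i],q^{2h_i})$,
whose factors are $[2(h_j-h_i)]$. One specialisation of the $h_i$ determines the constant. -/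
theorem det_crossEntry {q : K} (hq0 : q ≠ 0) (hq : ∀ k : ℕ, 1 ≤ k → qInt (q ^ 2) k ≠ 0)
    (N : ℤ) {n : ℕ} (h : Fin n → ℤ) :
    (Matrix.of fun k i : Fin n => crossEntry q N n k (h i)).det =
      (∏ i : Fin n, ∏ j ∈ Ioi i, symInt q (2 * (h j - h i))) *
        ∏ k : Fin n, ∏ l ∈ range k, symInt q (2 * (2 * N + k + l)) := by
  choose c hc using fun k => crossEntry_eq_sum hq0 N (n := n) k
  have hdet : ∀ h : Fin n → ℤ, (Matrix.of fun k i : Fin n => crossEntry q N n k (h i)).det =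
      (∏ i : Fin n, ∏ j ∈ Ioi i, symInt q (2 * (h j - h i))) * (Matrix.of c).det := by
    intro h
    have h1 : (Matrix.of fun k i : Fin n => crossEntry q N n k (h i)) =
        Matrix.of c * (Matrix.projVandermonde (fun i => symInt q (2 * h i))
          (fun i => q ^ (2 * h i))).transpose := by
      ext k i
      rw [Matrix.mul_apply, Matrix.of_apply, hc]
      refine sum_congr rfl fun m _ => ?_
      rw [Matrix.transpose_apply, Matrix.projVandermonde_apply, Matrix.of_apply]
      ring
    rw [h1, Matrix.det_mul, Matrix.det_transpose, Matrix.det_projVandermonde, mul_comm]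
    congr 1
    refine prod_congr rfl fun i _ => prod_congr rfl fun j _ => ?_
    rw [show 2 * (h j - h i) = 2 * h j + -(2 * h i) by ring, symInt_add hq0, symInt_neg, neg_neg]
    ring
  -- At $h_i=N+i$ the entries with $k<i$ contain $[0]$, so the matrix is triangular; the second
  -- products on its diagonal are the Vandermonde factors at this point.
  have hspec := hdet fun i => N + (i : ℕ)
  have htri : (Matrix.of fun k i : Fin n => crossEntry q N n k (N + (i : ℕ))).BlockTriangular
      OrderDual.toDual := by
    intro k i hki
    have hki' : k < i := hki
    rw [Matrix.of_apply, crossEntry, prod_eq_zero (s := Ico _ _) (i := (i : ℕ)), mul_zero]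
    · rw [mem_Ico]
      exact ⟨hki', i.2⟩
    · rw [sub_self, mul_zero, symInt_zero]
  rw [Matrix.det_of_isLowerTriangular _ htri] at hspec
  have h2 : ∀ i : Fin n, ∏ j ∈ Ioi i, symInt q (2 * (N + (j : ℕ) - (N + (i : ℕ)))) =
      ∏ l ∈ Ico ((i : ℕ) + 1) n, symInt q (2 * (N + l - (N + (i : ℕ)))) := fun i =>
    prod_Ioi_fin i fun l => symInt q (2 * (N + l - (N + (i : ℕ))))
  rw [prod_congr rfl fun i _ => h2 i] at hspec
  simp only [Matrix.of_apply, crossEntry] at hspec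
  rw [prod_mul_distrib, mul_comm] at hspec
  have h3 : ∏ i : Fin n, ∏ l ∈ Ico ((i : ℕ) + 1) n, symInt q (2 * (N + l - (N + (i : ℕ)))) ≠ 0 := by
    refine prod_ne_zero_iff.2 fun i _ => prod_ne_zero_iff.2 fun l hl => ?_
    rw [mem_Ico] at hl
    exact symInt_ne_zero hq0 hq (by omega)
  rw [hdet h, ← mul_left_cancel₀ h3 hspec]
  congr 1
  refine prod_congr rfl fun k _ => prod_congr rfl fun l _ => ?_
  congr 1
  ring

/-- The arguments run from $2M+2h$ down to $2M-2h$ in steps of 2 and pair off symmetrically about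
$2M$; the extra $[2M]$ completes the middle pair. -/
theorem symInt_mul_prod_range (q : K) (M : ℤ) (h : ℕ) :
    symInt q (2 * M) * ∏ i ∈ range (2 * h + 1), symInt q (2 * M + (2 * h + 1 : ℕ) - 1 - 2 * i) =
      ∏ i ∈ range (h + 1), symInt q (2 * (M + i)) * symInt q (2 * (M - i)) := by
  induction h with
  | zero => simp
  | succ h ih =>
    rw [prod_range_succ _ (h + 1), ← ih, show 2 * (h + 1) + 1 = (2 * h + 1) + 1 + 1 by ring,
      prod_range_succ, prod_range_succ']
    have e1 : ∀ i ∈ range (2 * h + 1),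
        symInt q (2 * M + (2 * h + 1 + 1 + 1 : ℕ) - 1 - 2 * (i + 1 : ℕ)) =
        symInt q (2 * M + (2 * h + 1 : ℕ) - 1 - 2 * i) := fun i _ => by
      congr 1; push_cast; ring
    have e2 : symInt q (2 * M + (2 * h + 1 + 1 + 1 : ℕ) - 1 - 2 * (0 : ℕ)) =
        symInt q (2 * (M + (h + 1 : ℕ))) := by congr 1; push_cast; ring
    have e3 : symInt q (2 * M + (2 * h + 1 + 1 + 1 : ℕ) - 1 - 2 * (2 * h + 1 + 1 : ℕ)) =
        symInt q (2 * (M - (h + 1 : ℕ))) := by congr 1; push_cast; ring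
    rw [prod_congr rfl e1, e2, e3]
    ring

theorem axisPathGF_two_mul (q : K) (h : ℕ) (M : ℤ) :
    axisPathGF q (2 * h) (2 * M) = (4 ^ h)⁻¹ *
      (∏ i ∈ range h, symInt q (2 * (M + i)) * symInt q (2 * (M - i))) /
      ∏ i ∈ range (2 * h), symInt q ((i : ℤ) + 1) := by
  cases h with
  | zero => simp [axisPathGF]
  | succ h =>
    rw [show 2 * (h + 1) = 2 * h + 1 + 1 by ring, axisPathGF_succ, symInt_mul_prod_range,
      show 2 * h + 1 + 1 = 2 * (h + 1) by ring, pow_mul]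
    norm_num

/-- Both sides multiply `f` over the integers from $k-h+1$ to $n-1$, cut at different places. -/
theorem prod_mul_prod_Ico_shift (f : ℤ → K) {n k : ℕ} (hk : k < n) (h : ℕ) :
    (∏ i ∈ range h, f ((k : ℤ) - i)) * ∏ l ∈ Ico (k + 1) n, f l =
      (∏ i ∈ range h, f ((n : ℤ) - 1 - i)) * ∏ l ∈ Ico (k + 1) n, f ((l : ℤ) - h) := by
  obtain ⟨n, rfl⟩ : ∃ m, n = m + 1 := ⟨n - 1, by omega⟩
  induction h with
  | zero => simp
  | succ h ih =>
    rw [prod_range_succ, prod_range_succ, mul_right_comm, ih]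
    have h1 : f ((k : ℤ) - h) * ∏ l ∈ Ico (k + 1) (n + 1), f ((l : ℤ) - h) =
        f (((n + 1 : ℕ) : ℤ) - 1 - h) * ∏ l ∈ Ico (k + 1) (n + 1), f ((l : ℤ) - (h + 1 : ℕ)) := by
      rw [← prod_eq_prod_Ico_succ_bot hk (fun l : ℕ => f ((l : ℤ) - h)),
        prod_Ico_succ_top (by omega), mul_comm]
      congr 1
      · congr 1; push_cast; ring
      · rw [← prod_Ico_add' (fun l : ℕ => f ((l : ℤ) - (h + 1 : ℕ))) k n 1]
        refine prod_congr rfl fun l _ => ?_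
        congr 1; push_cast; ring
    linear_combination (∏ i ∈ range h, f (((n + 1 : ℕ) : ℤ) - 1 - i)) * h1

theorem prod_range_mul_prod_range_shift (f : ℤ → K) (k h : ℕ) :
    (∏ i ∈ range h, f ((k : ℤ) + i)) * ∏ l ∈ range k, f l =
      (∏ i ∈ range h, f i) * ∏ l ∈ range k, f ((l : ℤ) + h) := by
  have h1 := prod_range_add (fun i : ℕ => f i) k h
  rw [add_comm k h, prod_range_add] at h1
  push_cast at h1
  rw [mul_comm, ← h1]
  congr 1
  exact prod_congr rfl fun l _ => by rw [add_comm]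

/-- The row factor depends only on $k$ and the factor on the right only on $h$. The two shift lemmas
trade the $h$-fold products that depend on $k$ for products that do not. -/
theorem axisPathGF_mul_eq_crossEntry (q : K) (N : ℤ) {n k : ℕ} (hk : k < n) (h : ℕ) :
    ((∏ l ∈ range k, symInt q (2 * (N + l))) * ∏ l ∈ Ico (k + 1) n, symInt q (2 * (N + l))) *
        axisPathGF q (2 * h) (2 * (N + k)) =
      ((4 ^ h)⁻¹ * (∏ i ∈ range h, symInt q (2 * (N + i)) * symInt q (2 * (N + (n - 1 - i)))) /
        ∏ i ∈ range (2 * h), symInt q ((i : ℤ) + 1)) * crossEntry q N n k h := by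
  have h1 := prod_mul_prod_Ico_shift (fun z => symInt q (2 * (N + z))) hk h
  have h2 := prod_range_mul_prod_range_shift (fun z => symInt q (2 * (N + z))) k h
  simp only [← add_assoc, ← add_sub_assoc] at h1 h2 ⊢
  rw [axisPathGF_two_mul, crossEntry, prod_mul_distrib, prod_mul_distrib]
  set D := ∏ i ∈ range (2 * h), symInt q ((i : ℤ) + 1)
  simp only [div_eq_mul_inv]
  linear_combination ((4 ^ h)⁻¹ * D⁻¹ * ((∏ i ∈ range h, symInt q (2 * (N + k + i))) *
    ∏ l ∈ range k, symInt q (2 * (N + l)))) * h1 + ((4 ^ h)⁻¹ * D⁻¹ *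
    ((∏ i ∈ range h, symInt q (2 * (N + n - 1 - i))) *
      ∏ l ∈ Ico (k + 1) n, symInt q (2 * (N + l - h)))) * h2

end

/-! ### The generating function as a product of symmetric q-integers -/

section
variable {K : Type*} [Field K]

/-- Reversing both indices turns the factors $f(n-1-r)$, $r\le i$, into the factors $f(l)$, $l\ge
i$. This exhibits the row factors inside the column factors, so that they can be cancelled. -/
theorem prod_symInt_rearrange (f : ℕ → K) (n : ℕ) :
    ∏ i : Fin n, ∏ r ∈ range ((i : ℕ) + 1), f r * f (n - 1 - r) =
      (∏ i : Fin n, (∏ l ∈ range i, f l) * ∏ l ∈ Ico ((i : ℕ) + 1) n, f l) *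
        ∏ i : Fin n, f i ^ 2 := by
  have h1 : ∏ i : Fin n, ∏ r ∈ range ((i : ℕ) + 1), f (n - 1 - r) =
      ∏ i : Fin n, ∏ l ∈ Ico (i : ℕ) n, f l := by
    refine Fintype.prod_equiv Fin.revPerm _ _ fun i => ?_
    rw [Fin.revPerm_apply, Fin.val_rev]
    have := i.2
    refine prod_bij' (fun r _ => n - 1 - r) (fun l _ => n - 1 - l) ?_ ?_ ?_ ?_
      (fun r _ => rfl) <;> simp only [mem_range, mem_Ico] <;> intro a ha
    · omega
    · omega
    · omega
    · omega
  simp only [prod_mul_distrib]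
  rw [h1, ← prod_mul_distrib, ← prod_mul_distrib, ← prod_mul_distrib]
  refine prod_congr rfl fun i _ => ?_
  rw [prod_range_succ, prod_eq_prod_Ico_succ_bot i.2]
  ring

theorem tilingGF_regionD_mul_eq [CharZero K] {q : K} (hq0 : q ≠ 0)
    (hq : ∀ k : ℕ, 1 ≤ k → qInt (q ^ 2) k ≠ 0)
    {x u n : ℕ} (hnu : n ≤ u) {h : Fin n → ℕ} (hmono : StrictMono h)
    (hmem : ∀ j, 1 ≤ h j ∧ h j ≤ u) {N : ℤ} (hN : N = x + u - n + 1) :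
    (∏ k : Fin n, (∏ l ∈ range k, symInt q (2 * (N + l))) *
        ∏ l ∈ Ico ((k : ℕ) + 1) n, symInt q (2 * (N + l))) *
        tilingGF (regionD x u h) (wt₂ q) =
      (∏ i : Fin n, ((4 ^ h i)⁻¹ *
          (∏ r ∈ range (h i), symInt q (2 * (N + r)) * symInt q (2 * (N + (n - 1 - r)))) /
          ∏ r ∈ range (2 * h i), symInt q ((r : ℤ) + 1))) *
        (∏ i : Fin n, ∏ j ∈ Ioi i, symInt q (2 * ((h j : ℤ) - h i))) *
        ∏ k : Fin n, ∏ t ∈ range k, (2 * symInt q (2 * N + (k : ℕ) + t)) := by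
  have hF := isPathGF_dentPathGF hq0 hq h
  have hpos : 1 ≤ N := by omega
  set c : ℕ → ℕ → K := fun t k => (q ^ (2 * N + k + t) + q ^ (-(2 * N + k + t))) / 2 with hc
  have hcs : ∀ t k : ℕ,
      symInt q (2 * (2 * N + k + t)) = c t k * (2 * symInt q (2 * N + k + t)) := by
    intro t k
    rw [symInt_two_mul hq0, hc]
    ring
  have hc0 : ∀ t k : ℕ, c t k ≠ 0 := by
    intro t k hcon
    have h1 := hcs t k
    rw [hcon, zero_mul] at h1
    exact symInt_ne_zero hq0 hq (by omega) h1
  -- After `t` rounds the point $(2N+k,k)$ has moved to $(2N+k+t,k-t)$; `c t k` is the weight of the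
  -- down step starting there when $t<k$.
  have hdet := det_eq_prod_mul_det_of_pascal_step
    (fun (i : Fin n) (t k : ℕ) => dentPathGF q (h i) (2 * N + k + t) ((k : ℤ) - t)) c
    (fun t k _ => hc0 t k) (by
      intro i t k _
      have h1 := hF.step i (2 * N + (k + 1 : ℕ) + (t + 1 : ℕ)) ((k : ℤ) - t) (by push_cast; omega)
        (by rw [Int.even_iff]; push_cast; omega)
      simp only [wt₂] at h1
      rw [if_neg (by push_cast; omega),
        show 2 * N + (k + 1 : ℕ) + (t + 1 : ℕ) - 1 = 2 * N + (k + 1 : ℕ) + t by push_cast; ring,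
        show 2 * N + (k + 1 : ℕ) + (t + 1 : ℕ) - 2 = 2 * N + k + t by push_cast; ring,
        show (k : ℤ) - t + 1 = (k + 1 : ℕ) - t by push_cast; ring] at h1
      rw [← h1]
      congr 1
      push_cast
      ring)
  have hM := tilingGF_regionD_eq_det (x := x) hF hmono hnu hmem
  have e1 : (Matrix.of fun (k i : Fin n) => dentPathGF q (h i)
      (2 * (x : ℤ) + 2 * u - 2 * n + 2 + (k : ℕ)) (k : ℕ)) =
      Matrix.of fun (k i : Fin n) =>
        dentPathGF q (h i) (2 * N + (k : ℕ) + (0 : ℕ)) ((k : ℕ) - (0 : ℕ) : ℤ) := by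
    ext k i
    simp only [Matrix.of_apply]
    rw [hN]
    push_cast
    ring_nf
  rw [e1] at hM
  rw [← hM] at hdet
  have e2 : (Matrix.of fun (k i : Fin n) => dentPathGF q (h i)
      (2 * N + (k : ℕ) + (k : ℕ)) ((k : ℕ) - (k : ℕ) : ℤ)) =
      Matrix.of fun (k i : Fin n) => axisPathGF q (2 * h i) (2 * (N + (k : ℕ))) := by
    ext k i
    simp only [Matrix.of_apply, dentPathGF]
    rw [if_neg (by omega)]
    congr 1
    · omega
    · ring
  rw [e2] at hdet
  have h3 : (∏ k : Fin n, (∏ l ∈ range k, symInt q (2 * (N + l))) *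
        ∏ l ∈ Ico ((k : ℕ) + 1) n, symInt q (2 * (N + l))) *
        (Matrix.of fun (k i : Fin n) => axisPathGF q (2 * h i) (2 * (N + (k : ℕ)))).det =
      (∏ i : Fin n, ((4 ^ h i)⁻¹ *
          (∏ r ∈ range (h i), symInt q (2 * (N + r)) * symInt q (2 * (N + (n - 1 - r)))) /
          ∏ r ∈ range (2 * h i), symInt q ((r : ℤ) + 1))) *
      (Matrix.of fun (k i : Fin n) => crossEntry q N n k (h i)).det := by
    rw [← Matrix.det_mul_column, ← Matrix.det_mul_row]
    congr 1
    ext k i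
    exact axisPathGF_mul_eq_crossEntry q N k.2 (h i)
  rw [det_crossEntry hq0 hq N fun i => (h i : ℤ), hdet] at h3
  -- By $[2m]=(q^m+q^{-m})[m]$, the constant of the determinant contains exactly the factors
  -- produced by the row operations; they cancel and leave $2[m]$.
  have h4 : ∏ k : Fin n, ∏ l ∈ range k, symInt q (2 * (2 * N + (k : ℕ) + l)) =
      (∏ k : Fin n, ∏ t ∈ range k, c t k) *
        ∏ k : Fin n, ∏ t ∈ range k, (2 * symInt q (2 * N + (k : ℕ) + t)) := by
    rw [← prod_mul_distrib]
    refine prod_congr rfl fun k _ => ?_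
    rw [← prod_mul_distrib]
    exact prod_congr rfl fun t _ => hcs t k
  rw [h4] at h3
  have h5 : ∏ k : Fin n, ∏ t ∈ range k, c t k ≠ 0 :=
    prod_ne_zero_iff.2 fun k _ => prod_ne_zero_iff.2 fun t _ => hc0 t k
  refine mul_left_cancel₀ h5 ?_
  linear_combination h3

theorem tilingGF_regionD_eq_prod_symInt [CharZero K] {q : K} (hq0 : q ≠ 0)
    (hq : ∀ k : ℕ, 1 ≤ k → qInt (q ^ 2) k ≠ 0)
    {x u n : ℕ} (hnu : n ≤ u) {h : Fin n → ℕ} (hmono : StrictMono h)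
    (hmem : ∀ j, 1 ≤ h j ∧ h j ≤ u) (hle : ∀ i : Fin n, (i : ℕ) + 1 ≤ h i)
    {N : ℤ} (hN : N = x + u - n + 1) :
    tilingGF (regionD x u h) (wt₂ q) =
      (∏ i : Fin n, ((4 ^ h i)⁻¹ * 2 ^ (i : ℕ))) *
      ((∏ i : Fin n, ∏ j ∈ Ioi i, symInt q (2 * ((h j : ℤ) - h i))) /
        ∏ i : Fin n, ∏ r ∈ range (2 * h i), symInt q ((r : ℤ) + 1)) *
      (∏ i : Fin n, symInt q (2 * (N + (i : ℕ)))) *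
      (∏ i : Fin n, ∏ l ∈ range ((i : ℕ) + 1), symInt q (2 * N + (i : ℕ) + l)) *
      ∏ i : Fin n, ∏ r ∈ Ico ((i : ℕ) + 1) (h i),
        symInt q (2 * (N + r)) * symInt q (2 * (N + (n - 1 - r))) := by
  have hmain := tilingGF_regionD_mul_eq hq0 hq hnu hmono hmem hN
  have hcol : ∏ k : Fin n, (∏ l ∈ range k, symInt q (2 * (N + l))) *
        ∏ l ∈ Ico ((k : ℕ) + 1) n, symInt q (2 * (N + l)) ≠ 0 :=
    prod_ne_zero_iff.2 fun k _ => mul_ne_zero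
      (prod_ne_zero_iff.2 fun l _ => symInt_ne_zero hq0 hq (by omega))
      (prod_ne_zero_iff.2 fun l _ => symInt_ne_zero hq0 hq (by omega))
  refine mul_left_cancel₀ hcol ?_
  rw [hmain]
  -- Since $h_i\ge i+1$, the first $i+1$ factors can be split off; they absorb the row factors.
  have h1 : ∏ i : Fin n, ∏ r ∈ range (h i),
        symInt q (2 * (N + r)) * symInt q (2 * (N + (n - 1 - r))) =
      (∏ i : Fin n, ∏ r ∈ range ((i : ℕ) + 1),
        symInt q (2 * (N + r)) * symInt q (2 * (N + (n - 1 - r)))) *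
      ∏ i : Fin n, ∏ r ∈ Ico ((i : ℕ) + 1) (h i),
        symInt q (2 * (N + r)) * symInt q (2 * (N + (n - 1 - r))) := by
    rw [← prod_mul_distrib]
    exact prod_congr rfl fun i _ => (prod_range_mul_prod_Ico _ (hle i)).symm
  have h2 : ∏ i : Fin n, ∏ r ∈ range ((i : ℕ) + 1),
        symInt q (2 * (N + r)) * symInt q (2 * (N + (n - 1 - r))) =
      ∏ i : Fin n, ∏ r ∈ range ((i : ℕ) + 1),
        symInt q (2 * (N + r)) * symInt q (2 * (N + (n - 1 - r : ℕ))) := by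
    refine prod_congr rfl fun i _ => prod_congr rfl fun r hr => ?_
    rw [mem_range] at hr
    have := i.2
    congr 4
    omega
  have h3 : ∏ i : Fin n, ∏ l ∈ range ((i : ℕ) + 1), symInt q (2 * N + (i : ℕ) + l) =
      (∏ i : Fin n, ∏ l ∈ range i, symInt q (2 * N + (i : ℕ) + l)) *
        ∏ i : Fin n, symInt q (2 * (N + (i : ℕ))) := by
    rw [← prod_mul_distrib]
    refine prod_congr rfl fun i _ => ?_
    rw [prod_range_succ]
    congr 2
    ring
  have h4 : ∏ k : Fin n, ∏ t ∈ range k, (2 * symInt q (2 * N + (k : ℕ) + t)) =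
      (∏ k : Fin n, (2 : K) ^ (k : ℕ)) *
        ∏ k : Fin n, ∏ t ∈ range k, symInt q (2 * N + (k : ℕ) + t) := by
    rw [← prod_mul_distrib]
    refine prod_congr rfl fun i _ => ?_
    rw [prod_mul_distrib, prod_const, card_range]
  have h5 := prod_symInt_rearrange (fun l : ℕ => symInt q (2 * (N + l))) n
  rw [prod_div_distrib, prod_mul_distrib, h1, h2, h5, h3, h4, prod_pow,
    prod_mul_distrib (f := fun i : Fin n => ((4 : K) ^ h i)⁻¹)]
  ring

end

/-! ### Powers of q and comparison with the product P -/

theorem prod_Icc_one {M : Type*} [CommMonoid M] (f : ℕ → M) (m : ℕ) :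
    ∏ k ∈ Icc 1 m, f k = ∏ r ∈ range m, f (r + 1) := by
  induction m with
  | zero => simp
  | succ m ih => rw [prod_Icc_succ_top (by omega), prod_range_succ, ih]

theorem two_mul_sum_range_add (c : ℤ) (m : ℕ) :
    2 * ∑ r ∈ range m, (c + r) = m * (2 * c + m - 1) := by
  induction m with
  | zero => simp
  | succ m ih =>
    rw [sum_range_succ, mul_add, ih]
    push_cast
    ring

theorem two_mul_bracketSum {a b : ℤ} (hab : a ≤ b + 1) :
    2 * bracketSum b a = (b - a + 1) * (a + b) := by
  obtain ⟨m, hm⟩ := Int.eq_ofNat_of_zero_le (show 0 ≤ b + 1 - a by omega)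
  have hb : b = a + m - 1 := by omega
  subst hb
  clear hab hm
  unfold bracketSum
  induction m with
  | zero => simp
  | succ m ih =>
    have h1 : Icc a (a + (m + 1 : ℕ) - 1) = insert (a + m : ℤ) (Icc a (a + m - 1)) := by
      ext z
      simp only [mem_Icc, mem_insert]
      push_cast
      omega
    rw [h1, sum_insert (by simp), mul_add, ih]
    push_cast
    ring

theorem sum_sum_Ioi_sub {n : ℕ} (g : Fin n → ℤ) :
    ∑ i : Fin n, ∑ j ∈ Ioi i, (2 * (g j - g i) - 1) =
      ∑ i : Fin n, (2 * g i * (2 * (i : ℕ) - n + 1) - (i : ℕ)) := by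
  have h1 : ∀ f : Fin n → ℤ, ∑ i : Fin n, ∑ j ∈ Ioi i, f j = ∑ j : Fin n, (j : ℕ) * f j := by
    intro f
    rw [sum_comm' (t' := univ) (s' := fun j => Iio j) (by simp)]
    refine sum_congr rfl fun j _ => ?_
    rw [sum_const, Fin.card_Iio, nsmul_eq_mul]
  have h2 : ∀ f : Fin n → ℤ, ∑ i : Fin n, ∑ _j ∈ Ioi i, f i =
      ∑ i : Fin n, (n - 1 - (i : ℕ)) * f i := by
    intro f
    refine sum_congr rfl fun i _ => ?_
    rw [sum_const, Fin.card_Ioi, nsmul_eq_mul]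
    have := i.2
    congr 1
    omega
  have h3 : ∑ i : Fin n, ∑ j ∈ Ioi i, (2 * (g j - g i) - 1) =
      ∑ i : Fin n, ∑ j ∈ Ioi i, (2 * g j - 1) - ∑ i : Fin n, ∑ _j ∈ Ioi i, 2 * g i := by
    simp only [← sum_sub_distrib]
    refine sum_congr rfl fun i _ => sum_congr rfl fun j _ => ?_
    ring
  rw [h3, h1, h2, ← sum_sub_distrib]
  refine sum_congr rfl fun i _ => ?_
  ring

/-- The powers of `q` in `prodP` cancel when it is written in terms of symmetric `q`-integers. -/
theorem exponent_eq {x u n X : ℕ} (hnu : n ≤ u) (hX : X = x + (u - n)) (h : Fin n → ℕ)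
    (hle : ∀ i : Fin n, (i : ℕ) + 1 ≤ h i) :
    expE x u 0 (![] : Fin 0 → ℕ) h =
      (∑ i : Fin n, ∑ j ∈ Ioi i, (2 * ((h j : ℤ) - h i) - 1)) -
        (∑ i : Fin n, ∑ r ∈ range (2 * h i), ((0 : ℤ) + r)) +
        (∑ i : Fin n, (2 * (X : ℤ) + 2 * (i : ℕ) + 1)) +
        (∑ i : Fin n, ∑ l ∈ range ((i : ℕ) + 1), (2 * (X : ℤ) + (i : ℕ) + 1 + l)) +
        ∑ i : Fin n, ∑ _r ∈ Ico ((i : ℕ) + 1) (h i), (4 * (X : ℤ) + 2 * n) := by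
  have hE : expE x u 0 (![] : Fin 0 → ℕ) h = fExp (2 * X + 1) n 1 +
      ∑ i : Fin n, bracketSum (2 * X + (i : ℕ)) (2 * X + 2 * ((i : ℕ) + 1) - 2 * h i) := by
    simp only [expE, univ_eq_empty, sum_empty, add_zero, Nat.cast_zero, mul_zero, sub_zero,
      zero_add]
    rw [min_eq_right (by omega)]
    congr 1
    · congr 1
      omega
    · refine sum_congr rfl fun i _ => ?_
      congr 1 <;> omega
  -- Doubling removes the halves from `fExp` and from the arithmetic sums.
  refine mul_left_cancel₀ (two_ne_zero (α := ℤ)) ?_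
  have hd : ∀ a b c d e : ℤ, 2 * (a - b + c + d + e) = 2 * a - 2 * b + 2 * c + 2 * d + 2 * e := by
    intros
    ring
  rw [hE, sum_sum_Ioi_sub, hd, mul_add 2 (fExp _ _ _), two_mul_fExp]
  simp only [mul_sum (s := univ)]
  have e1 : ∀ i : Fin n, 2 * bracketSum (2 * X + (i : ℕ)) (2 * X + 2 * ((i : ℕ) + 1) - 2 * h i) =
      (2 * h i - (i : ℕ) - 1) * (4 * X + 3 * (i : ℕ) + 2 - 2 * h i) := by
    intro i
    have := hle i
    rw [two_mul_bracketSum (by omega)]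
    ring
  have e2 : ∀ i : Fin n, 2 * ∑ _r ∈ Ico ((i : ℕ) + 1) (h i), (4 * (X : ℤ) + 2 * n) =
      2 * (h i - (i : ℕ) - 1) * (4 * (X : ℤ) + 2 * n) := by
    intro i
    have := hle i
    rw [sum_const, Nat.card_Ico, nsmul_eq_mul, Nat.cast_sub this]
    push_cast
    ring
  have e3 : ∀ m : ℕ, ∑ i ∈ range m, (4 * (X : ℤ) + 2 * i + 2) = m * (4 * X + m + 1) := by
    intro m
    induction m with
    | zero => simp
    | succ m ih => rw [sum_range_succ, ih]; push_cast; ring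
  -- The two sides do not agree term by term: their summands differ by this polynomial in `i`,
  -- independent of the $h_i$, whose sum vanishes at $m=n$.
  have e4 : ∀ m : ℕ,
      ∑ i ∈ range m, (6 * ((i : ℤ) + 1) ^ 2 - 2 * ((i : ℤ) + 1) - 4 * (n : ℤ) * ((i : ℤ) + 1)) =
      (m : ℤ) * (m + 1) * (2 * m - 2 * n) := by
    intro m
    induction m with
    | zero => simp
    | succ m ih => rw [sum_range_succ, ih]; push_cast; ring
  have e5 := e3 n
  have e6 := e4 n
  rw [← Fin.sum_univ_eq_sum_range (fun i : ℕ => 4 * (X : ℤ) + 2 * i + 2)] at e5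
  rw [← Fin.sum_univ_eq_sum_range
    (fun i : ℕ => 6 * ((i : ℤ) + 1) ^ 2 - 2 * ((i : ℤ) + 1) - 4 * (n : ℤ) * ((i : ℤ) + 1)),
    sub_self, mul_zero] at e6
  have e7 : (n : ℤ) * 1 * (2 * (2 * X + 1) + n - 1) = n * (4 * X + n + 1) := by ring
  rw [e7, ← e5]
  refine sub_eq_zero.1 (neg_eq_zero.1 (Eq.trans ?_ e6))
  simp only [e1, e2, two_mul_sum_range_add]
  simp only [← sum_add_distrib, ← sum_sub_distrib, ← sum_neg_distrib]
  refine sum_congr rfl fun i _ => ?_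
  push_cast
  ring

section
variable {K : Type*} [Field K]

theorem prod_zpow_mul {ι : Type*} {q : K} (hq0 : q ≠ 0) (s : Finset ι) (e : ι → ℤ) (b : ι → K) :
    ∏ i ∈ s, (q ^ e i * b i) = q ^ (∑ i ∈ s, e i) * ∏ i ∈ s, b i := by
  classical
  induction s using Finset.induction_on with
  | empty => simp
  | insert a s ha ih =>
    rw [prod_insert ha, prod_insert ha, sum_insert ha, ih, zpow_add₀ hq0]
    ring

theorem qInt_eq_zpow_mul {q : K} (hq0 : q ≠ 0) {m : ℕ} {e k : ℤ} (hk : (m : ℤ) = k)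
    (he : e = k - 1) : qInt (q ^ 2) m = q ^ e * symInt q k := by
  rw [qInt_eq_symInt hq0, he, hk]

theorem prodP_eq_prod_symInt [CharZero K] {q : K} (hq0 : q ≠ 0)
    {x u n X : ℕ} (hnu : n ≤ u) (hX : X = x + (u - n)) {h : Fin n → ℕ} (hmono : StrictMono h)
    (hu : ∀ i, h i ≤ u) (hle : ∀ i : Fin n, (i : ℕ) + 1 ≤ h i)
    {N : ℤ} (hN : N = X + 1) :
    prodP q x u 0 (![] : Fin 0 → ℕ) h =
      (∏ i : Fin n, ((4 ^ h i)⁻¹ * 2 ^ (i : ℕ))) *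
      ((∏ i : Fin n, ∏ j ∈ Ioi i, symInt q (2 * ((h j : ℤ) - h i))) /
        ∏ i : Fin n, ∏ r ∈ range (2 * h i), symInt q ((r : ℤ) + 1)) *
      (∏ i : Fin n, symInt q (2 * (N + (i : ℕ)))) *
      (∏ i : Fin n, ∏ l ∈ range ((i : ℕ) + 1), symInt q (2 * N + (i : ℕ) + l)) *
      ∏ i : Fin n, ∏ r ∈ Ico ((i : ℕ) + 1) (h i),
        symInt q (2 * (N + r)) * symInt q (2 * (N + (n - 1 - r))) := by
  have hP : prodP q x u 0 (![] : Fin 0 → ℕ) h =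
      2 ^ (-expF (![] : Fin 0 → ℕ) h) * q ^ (-expE x u 0 (![] : Fin 0 → ℕ) h) *
      ((∏ i : Fin n, ∏ j ∈ Ioi i, qInt (q ^ 2) (2 * (h j - h i))) /
        ∏ i : Fin n, qFact (q ^ 2) (2 * h i)) *
      (∏ i ∈ Icc 1 n, qInt (q ^ 2) (2 * (X + i))) *
      (∏ i ∈ Icc 1 n, ∏ j ∈ Icc 1 i, qInt (q ^ 2) (2 * X + i + j)) *
      ∏ i : Fin n, ∏ j ∈ Icc 1 (h i - ((i : ℕ) + 1)),
        qInt (q ^ 2) (2 * (X + (i + 1) + j)) * qInt (q ^ 2) (2 * (X + n - i - j)) := by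
    simp [prodP, hX]
  have h2 : (2 : K) ^ (-expF (![] : Fin 0 → ℕ) h) = ∏ i : Fin n, ((4 ^ h i)⁻¹ * 2 ^ (i : ℕ)) := by
    have e1 : ∀ i : Fin n, ((4 : K) ^ h i)⁻¹ * 2 ^ (i : ℕ) = 2 ^ ((i : ℕ) - 2 * h i : ℤ) * 1 := by
      intro i
      rw [mul_one, zpow_sub₀ two_ne_zero, zpow_natCast, zpow_mul]
      norm_num
      rw [mul_comm, div_eq_mul_inv]
    rw [prod_congr rfl fun i _ => e1 i, prod_zpow_mul two_ne_zero, prod_const_one, mul_one]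
    congr 1
    simp only [expF, univ_eq_empty, sum_empty, Nat.cast_zero, zero_add, mul_one, add_zero]
    have e2 : (n : ℤ) = ∑ _i : Fin n, 1 := by simp
    rw [e2, ← sum_add_distrib, ← sum_neg_distrib]
    refine sum_congr rfl fun i _ => ?_
    ring
  have hV : ∏ i : Fin n, ∏ j ∈ Ioi i, qInt (q ^ 2) (2 * (h j - h i)) =
      q ^ (∑ i : Fin n, ∑ j ∈ Ioi i, (2 * ((h j : ℤ) - h i) - 1)) *
        ∏ i : Fin n, ∏ j ∈ Ioi i, symInt q (2 * ((h j : ℤ) - h i)) := by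
    rw [← prod_zpow_mul hq0]
    refine prod_congr rfl fun i _ => ?_
    rw [← prod_zpow_mul hq0]
    refine prod_congr rfl fun j hj => qInt_eq_zpow_mul hq0 ?_ rfl
    have := hmono (mem_Ioi.1 hj)
    push_cast [this.le]
    ring
  have hFact : ∏ i : Fin n, qFact (q ^ 2) (2 * h i) =
      q ^ (∑ i : Fin n, ∑ r ∈ range (2 * h i), ((0 : ℤ) + r)) *
        ∏ i : Fin n, ∏ r ∈ range (2 * h i), symInt q ((r : ℤ) + 1) := by
    rw [← prod_zpow_mul hq0]
    refine prod_congr rfl fun i _ => ?_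
    rw [← prod_zpow_mul hq0, qFact, prod_Icc_one]
    refine prod_congr rfl fun r _ => qInt_eq_zpow_mul hq0 ?_ ?_
    · push_cast; ring
    · ring
  have hA : ∏ i ∈ Icc 1 n, qInt (q ^ 2) (2 * (X + i)) =
      q ^ (∑ i : Fin n, (2 * (X : ℤ) + 2 * (i : ℕ) + 1)) *
        ∏ i : Fin n, symInt q (2 * (N + (i : ℕ))) := by
    rw [← prod_zpow_mul hq0, prod_Icc_one, ← Fin.prod_univ_eq_prod_range
      (fun r => qInt (q ^ 2) (2 * (X + (r + 1))))]
    refine prod_congr rfl fun i _ => qInt_eq_zpow_mul hq0 ?_ ?_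
    · rw [hN]; push_cast; ring
    · rw [hN]; ring
  have hB : ∏ i ∈ Icc 1 n, ∏ j ∈ Icc 1 i, qInt (q ^ 2) (2 * X + i + j) =
      q ^ (∑ i : Fin n, ∑ l ∈ range ((i : ℕ) + 1), (2 * (X : ℤ) + (i : ℕ) + 1 + l)) *
        ∏ i : Fin n, ∏ l ∈ range ((i : ℕ) + 1), symInt q (2 * N + (i : ℕ) + l) := by
    rw [← prod_zpow_mul hq0, prod_Icc_one, ← Fin.prod_univ_eq_prod_range
      (fun r => ∏ j ∈ Icc 1 (r + 1), qInt (q ^ 2) (2 * X + (r + 1) + j))]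
    refine prod_congr rfl fun i _ => ?_
    rw [← prod_zpow_mul hq0, prod_Icc_one]
    refine prod_congr rfl fun l _ => qInt_eq_zpow_mul hq0 ?_ ?_
    · rw [hN]; push_cast; ring
    · rw [hN]; ring
  have hC : ∏ i : Fin n, ∏ j ∈ Icc 1 (h i - ((i : ℕ) + 1)),
        qInt (q ^ 2) (2 * (X + (i + 1) + j)) * qInt (q ^ 2) (2 * (X + n - i - j)) =
      q ^ (∑ i : Fin n, ∑ _r ∈ Ico ((i : ℕ) + 1) (h i), (4 * (X : ℤ) + 2 * n)) *
        ∏ i : Fin n, ∏ r ∈ Ico ((i : ℕ) + 1) (h i),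
          symInt q (2 * (N + r)) * symInt q (2 * (N + (n - 1 - r))) := by
    rw [← prod_zpow_mul hq0]
    refine prod_congr rfl fun i _ => ?_
    rw [← prod_zpow_mul hq0, prod_Icc_one, prod_Ico_eq_prod_range]
    refine prod_congr rfl fun r hr => ?_
    rw [mem_range] at hr
    -- Since $X+n=x+u$, the bound $h_i\le u$ keeps the natural subtraction in the second factor from
    -- truncating.
    have := hu i
    rw [qInt_eq_zpow_mul hq0 (k := 2 * (N + ((i : ℕ) + 1 + r : ℕ))) (by omega) rfl,
      qInt_eq_zpow_mul hq0 (k := 2 * (N + (n - 1 - ((i : ℕ) + 1 + r : ℕ)))) (by omega) rfl,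
      mul_mul_mul_comm, ← zpow_add₀ hq0]
    congr 2
    rw [hN]
    ring
  have hE : q ^ (-expE x u 0 (![] : Fin 0 → ℕ) h) *
      (q ^ (∑ i : Fin n, ∑ j ∈ Ioi i, (2 * ((h j : ℤ) - h i) - 1)) /
        q ^ (∑ i : Fin n, ∑ r ∈ range (2 * h i), ((0 : ℤ) + r))) *
      q ^ (∑ i : Fin n, (2 * (X : ℤ) + 2 * (i : ℕ) + 1)) *
      q ^ (∑ i : Fin n, ∑ l ∈ range ((i : ℕ) + 1), (2 * (X : ℤ) + (i : ℕ) + 1 + l)) *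
      q ^ (∑ i : Fin n, ∑ _r ∈ Ico ((i : ℕ) + 1) (h i), (4 * (X : ℤ) + 2 * n)) = 1 := by
    rw [← zpow_sub₀ hq0, ← zpow_add₀ hq0, ← zpow_add₀ hq0, ← zpow_add₀ hq0, ← zpow_add₀ hq0,
      ← zpow_zero q, exponent_eq hnu hX h hle]
    congr 1
    ring
  rw [hP, h2, hV, hFact, hA, hB, hC, mul_div_mul_comm]
  linear_combination ((∏ i : Fin n, ((4 ^ h i)⁻¹ * 2 ^ (i : ℕ))) *
      ((∏ i : Fin n, ∏ j ∈ Ioi i, symInt q (2 * ((h j : ℤ) - h i))) /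
        ∏ i : Fin n, ∏ r ∈ range (2 * h i), symInt q ((r : ℤ) + 1)) *
      (∏ i : Fin n, symInt q (2 * (N + (i : ℕ)))) *
      (∏ i : Fin n, ∏ l ∈ range ((i : ℕ) + 1), symInt q (2 * N + (i : ℕ) + l)) *
      ∏ i : Fin n, ∏ r ∈ Ico ((i : ℕ) + 1) (h i),
        symInt q (2 * (N + r)) * symInt q (2 * (N + (n - 1 - r)))) * hE

end

theorem mainTheorem10 {K : Type*} [Field K] [CharZero K] (q : K) (hq0 : q ≠ 0)
    (hq : ∀ k : ℕ, 1 ≤ k → qInt (q ^ 2) k ≠ 0)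
    (x u n : ℕ) (hnu : n ≤ u) (h : Fin n → ℕ) (hmono : StrictMono h)
    (hmem : ∀ j, 1 ≤ h j ∧ h j ≤ u) :
    tilingGF (regionD x u h) (wt₂ q) = prodP q x u 0 (![] : Fin 0 → ℕ) h := by
  have hle : ∀ i : Fin n, (i : ℕ) + 1 ≤ h i := by
    rintro ⟨i, hi⟩
    induction i with
    | zero => exact (hmem _).1
    | succ i ih =>
      have h1 := ih (by omega)
      have h2 := hmono (show (⟨i, by omega⟩ : Fin n) < ⟨i + 1, hi⟩ by simp)
      simp only at h1 ⊢
      omega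
  rw [tilingGF_regionD_eq_prod_symInt hq0 hq hnu hmono hmem hle rfl,
    prodP_eq_prod_symInt hq0 hnu rfl hmono (fun i => (hmem i).2) hle]
  push_cast [hnu]
  ring
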